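/- A packing $k$-coloring of a graph $G=(V,E)$ is a map $\varphi:V\to\{1,\dots,k\}$ such that any two distinct vertices $u,v$ with $\varphi(u)=\varphi(v)$ are at distance at least $\varphi(u)+1$ in $G$; the packing chromatic number $\chi_P(G)$ is the smallest $k$ for which $G$ has a packing $k$-coloring. There is an algorithm which, given an integer $d\ge 1$ and the adjacency matrix of a nonempty interval graph $G$ of diameter at most $d$ (in particular $G$ is connected), computes $\chi_P(G)$ in time $O\bigl(n^{d\ln(5d)}\bigr)$, where $n$ is the number of vertices of $G$ and the implied constant depends only on $d$. Here time is the number of steps of a unit-cost random access machine whose words have, for each fixed $d$, $O(\log n)$ bits. -/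

import Mathlib

/-- `G` is an interval graph: its vertices can be represented by nonempty closed intervals of the
real line such that two distinct vertices are adjacent exactly when their intervals intersect. -/
def SimpleGraph.IsIntervalGraph {V : Type*} (G : SimpleGraph V) : Prop :=
  ∃ l r : V → ℝ, (∀ v, l v ≤ r v) ∧
    ∀ u v, u ≠ v → (G.Adj u v ↔ (Set.Icc (l u) (r u) ∩ Set.Icc (l v) (r v)).Nonempty)

/-- `φ` is a packing `k`-coloring of `G`: the colors are `1, …, k`, and two distinct vertices of
the same color `c` are at distance at least `c + 1` (the distance is infinite between different
components). -/
def SimpleGraph.IsPackingColoring {V : Type*} (G : SimpleGraph V) (k : ℕ) (φ : V → ℕ) : Prop :=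
  (∀ v, 1 ≤ φ v ∧ φ v ≤ k) ∧
    ∀ u v, u ≠ v → φ u = φ v → ((φ u + 1 : ℕ) : ℕ∞) ≤ G.edist u v

/-- The smallest `k` for which `G` has a packing `k`-coloring (`⊤` if there is none). -/
noncomputable def SimpleGraph.packingChromaticNumber {V : Type*} (G : SimpleGraph V) : ℕ∞ :=
  ⨅ k ∈ {k : ℕ | ∃ φ, G.IsPackingColoring k φ}, (k : ℕ∞)

/-! ### Random access machines

A machine has registers and a random access memory; every register and every memory cell holds a
natural number. A program is built from unit-cost instructions by sequencing, branching and
looping, and mentions only finitely many registers. -/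

namespace RAM

/-- The contents of the registers and of the memory. -/
structure State where
  reg : ℕ → ℕ
  mem : ℕ → ℕ

/-- Write `a` into register `x`. -/
def State.setReg (s : State) (x a : ℕ) : State :=
  { s with reg := Function.update s.reg x a }

/-- Write `a` into the memory cell with address `i`. -/
def State.setMem (s : State) (i a : ℕ) : State :=
  { s with mem := Function.update s.mem i a }

/-- Arithmetic operations on natural numbers; subtraction is truncated at `0`, and division and
remainder are those of natural numbers. -/
inductive Op
  | add
  | sub
  | mul
  | div
  | mod

def Op.eval : Op → ℕ → ℕ → ℕ
  | .add, a, b => a + b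
  | .sub, a, b => a - b
  | .mul, a, b => a * b
  | .div, a, b => a / b
  | .mod, a, b => a % b

/-- Comparisons of two registers. -/
inductive Test
  | lt (x y : ℕ)
  | eq (x y : ℕ)

def Test.Holds : Test → State → Prop
  | .lt x y, s => s.reg x < s.reg y
  | .eq x y, s => s.reg x = s.reg y

/-- Programs. Numbers `x y z` are names of registers. -/
inductive Prog
  | skip
  /-- `x := a` for a constant `a` -/
  | const (x a : ℕ)
  /-- `x := y` -/
  | copy (x y : ℕ)
  /-- `x := y o z` -/
  | arith (o : Op) (x y z : ℕ)
  /-- `x := mem[y]` -/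
  | load (x y : ℕ)
  /-- `mem[x] := y` -/
  | store (x y : ℕ)
  /-- `p; q` -/
  | seq (p q : Prog)
  /-- `if b then p else q` -/
  | cond (b : Test) (p q : Prog)
  /-- `while b do p` -/
  | loop (b : Test) (p : Prog)

/-- `Exec W p s t s'`: started in the state `s`, the program `p` halts in the state `s'` after
exactly `t` steps, and every number that it writes into a register is smaller than `W` (so that,
on inputs below `W`, all registers, memory cells and addresses in use fit into words of `log₂ W`
bits). Each instruction and each evaluation of a test is one step. -/
inductive Exec (W : ℕ) : Prog → State → ℕ → State → Prop
  | skip (s : State) : Exec W .skip s 1 s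
  | const (s : State) (x a : ℕ) (h : a < W) : Exec W (.const x a) s 1 (s.setReg x a)
  | copy (s : State) (x y : ℕ) (h : s.reg y < W) :
      Exec W (.copy x y) s 1 (s.setReg x (s.reg y))
  | arith (s : State) (o : Op) (x y z : ℕ) (h : o.eval (s.reg y) (s.reg z) < W) :
      Exec W (.arith o x y z) s 1 (s.setReg x (o.eval (s.reg y) (s.reg z)))
  | load (s : State) (x y : ℕ) (h : s.mem (s.reg y) < W) :
      Exec W (.load x y) s 1 (s.setReg x (s.mem (s.reg y)))
  | store (s : State) (x y : ℕ) :
      Exec W (.store x y) s 1 (s.setMem (s.reg x) (s.reg y))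
  | seq {p q : Prog} {s s' s'' : State} {t t' : ℕ}
      (hp : Exec W p s t s') (hq : Exec W q s' t' s'') : Exec W (.seq p q) s (t + t') s''
  | cond_true {b : Test} {p q : Prog} {s s' : State} {t : ℕ} (hb : b.Holds s)
      (hp : Exec W p s t s') : Exec W (.cond b p q) s (1 + t) s'
  | cond_false {b : Test} {p q : Prog} {s s' : State} {t : ℕ} (hb : ¬ b.Holds s)
      (hq : Exec W q s t s') : Exec W (.cond b p q) s (1 + t) s'
  | loop_stop {b : Test} {p : Prog} {s : State} (hb : ¬ b.Holds s) : Exec W (.loop b p) s 1 s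
  | loop_step {b : Test} {p : Prog} {s s' s'' : State} {t t' : ℕ} (hb : b.Holds s)
      (hp : Exec W p s t s') (hl : Exec W (.loop b p) s' t' s'') :
      Exec W (.loop b p) s (1 + t + t') s''

open Classical in
/-- The input: register `0` holds the number `n` of vertices, register `1` holds `d`, and the
memory holds the adjacency matrix of `G` row by row, the entry `(u, v)` at the address
`u * n + v`. Everything else is `0`. -/
noncomputable def input {n : ℕ} (d : ℕ) (G : SimpleGraph (Fin n)) : State where
  reg x := if x = 0 then n else if x = 1 then d else 0
  mem a := if ∃ u v : Fin n, a = (u : ℕ) * n + v ∧ G.Adj u v then 1 else 0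

end RAM

/-!
For `d = 1` the graph is complete and the answer is `n`. Let `d ≥ 2`. A color `c ≥ d` can be used
only once, so a packing coloring is a partial packing coloring with the colors below `d`, completed
by pairwise distinct colors from `d` on; one wants to color as many vertices as possible with the
colors below `d`.

*Colors `2, …, d - 1`.* In an interval graph, a shortest path between the leftmost and the rightmost
vertex of a set passes through the closed neighborhoods of all the others. Hence a set of vertices
with pairwise distances above `c` has at most `(d - 2) / (c - 1) + 1` elements
(`card_packing_le`), and giving every color this number of slots makes
`E ≤ (d - 2) (H_{d - 2} + 1)` slots in all. The program runs through all `(n + 1) ^ E` ways of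
putting at most one vertex into every slot, encoded as the digits of a number to the base `n + 1`,
and thereby meets every partial packing coloring with these colors (`exists_fill_eq`).

*Color `1`.* For each of them the color `1` should go to a maximum independent set of the remaining
vertices. It is found greedily: in every set of vertices, the one whose interval ends first is
simplicial (`exists_simplicial`), and exchanging at most one vertex puts a simplicial vertex into a
maximum independent set (`MisInv.step`). Recognizing simplicial vertices needs only the distances,
not an interval representation, and the greedy algorithm takes `O(n ^ 4)` steps.

*Time.* The total is `O(n ^ (E + 4))`, and `E + 4 ≤ d log (5 d)` because the Euler-Mascheroni
constant is smaller than `log 5 - 1` (`slotColors_length_add_four_le`).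

The functions of the section on the algorithm describe what the program does to its memory; they
follow it loop by loop, so that the correctness of the program (`wp_packingProg`) is separated from
that of the algorithm (`best_eq_packingChromaticNumber`). The distances are computed beforehand
(`relax_initMatrix`).
-/

/-! ### Weakest preconditions and for-loops -/

namespace RAM

@[simp] theorem State.setReg_reg (s : State) (x a y : ℕ) :
    (s.setReg x a).reg y = if y = x then a else s.reg y := by
  simp [State.setReg, Function.update_apply]

@[simp] theorem State.setReg_mem (s : State) (x a : ℕ) : (s.setReg x a).mem = s.mem := rfl

@[simp] theorem State.setMem_reg (s : State) (i a : ℕ) : (s.setMem i a).reg = s.reg := rfl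

@[simp] theorem State.setMem_mem (s : State) (i a : ℕ) :
    (s.setMem i a).mem = Function.update s.mem i a := rfl

@[simp] theorem Test.holds_lt (x y : ℕ) (s : State) :
    (Test.lt x y).Holds s ↔ s.reg x < s.reg y := Iff.rfl

@[simp] theorem Test.holds_eq (x y : ℕ) (s : State) :
    (Test.eq x y).Holds s ↔ s.reg x = s.reg y := Iff.rfl

/-- Started in `s`, the program `p` halts with words below `W`, and the number of steps and the
final state satisfy `Q`. -/
def wp (W : ℕ) (p : Prog) (Q : ℕ → State → Prop) (s : State) : Prop :=
  ∃ t s', Exec W p s t s' ∧ Q t s'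

variable {W : ℕ} {Q : ℕ → State → Prop} {s : State}

theorem wp_mono {Q' : ℕ → State → Prop} {p : Prog} (h : wp W p Q s)
    (hQ : ∀ t s', Q t s' → Q' t s') : wp W p Q' s := by
  obtain ⟨t, s', h, hq⟩ := h
  exact ⟨t, s', h, hQ _ _ hq⟩

theorem wp_skip : wp W .skip Q s ↔ Q 1 s := by
  constructor
  · rintro ⟨t, s', h, hq⟩
    cases h
    exact hq
  · exact fun h => ⟨_, _, .skip s, h⟩

theorem wp_const {x a : ℕ} : wp W (.const x a) Q s ↔ a < W ∧ Q 1 (s.setReg x a) := by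
  constructor
  · rintro ⟨t, s', h, hq⟩
    cases h with
    | const _ _ _ h => exact ⟨h, hq⟩
  · exact fun h => ⟨_, _, .const s x a h.1, h.2⟩

theorem wp_copy {x y : ℕ} :
    wp W (.copy x y) Q s ↔ s.reg y < W ∧ Q 1 (s.setReg x (s.reg y)) := by
  constructor
  · rintro ⟨t, s', h, hq⟩
    cases h with
    | copy _ _ _ h => exact ⟨h, hq⟩
  · exact fun h => ⟨_, _, .copy s x y h.1, h.2⟩

theorem wp_arith {o : Op} {x y z : ℕ} :
    wp W (.arith o x y z) Q s ↔ o.eval (s.reg y) (s.reg z) < W ∧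
      Q 1 (s.setReg x (o.eval (s.reg y) (s.reg z))) := by
  constructor
  · rintro ⟨t, s', h, hq⟩
    cases h with
    | arith _ _ _ _ _ h => exact ⟨h, hq⟩
  · exact fun h => ⟨_, _, .arith s o x y z h.1, h.2⟩

theorem wp_load {x y : ℕ} :
    wp W (.load x y) Q s ↔ s.mem (s.reg y) < W ∧ Q 1 (s.setReg x (s.mem (s.reg y))) := by
  constructor
  · rintro ⟨t, s', h, hq⟩
    cases h with
    | load _ _ _ h => exact ⟨h, hq⟩
  · exact fun h => ⟨_, _, .load s x y h.1, h.2⟩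

theorem wp_store {x y : ℕ} :
    wp W (.store x y) Q s ↔ Q 1 (s.setMem (s.reg x) (s.reg y)) := by
  constructor
  · rintro ⟨t, s', h, hq⟩
    cases h
    exact hq
  · exact fun h => ⟨_, _, .store s x y, h⟩

theorem wp_seq {p q : Prog} :
    wp W (.seq p q) Q s ↔ wp W p (fun t s' => wp W q (fun t' s'' => Q (t + t') s'') s') s := by
  constructor
  · rintro ⟨t, s', h, hq⟩
    cases h with
    | seq h₁ h₂ => exact ⟨_, _, h₁, _, _, h₂, hq⟩
  · rintro ⟨t, s', h₁, t', s'', h₂, hq⟩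
    exact ⟨_, _, .seq h₁ h₂, hq⟩

theorem wp_const_seq {x a : ℕ} {p : Prog} (ha : a < W) (h : wp W p Q (s.setReg x a)) :
    wp W (.seq (.const x a) p) (fun t s' => ∃ t', t = 1 + t' ∧ Q t' s') s :=
  wp_seq.2 (wp_const.2 ⟨ha, wp_mono h fun t _ hq => ⟨t, rfl, hq⟩⟩)

theorem wp_cond {b : Test} {p q : Prog} :
    wp W (.cond b p q) Q s ↔ (b.Holds s → wp W p (fun t s' => Q (1 + t) s') s) ∧
      (¬ b.Holds s → wp W q (fun t s' => Q (1 + t) s') s) := by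
  constructor
  · rintro ⟨t, s', h, hq⟩
    cases h with
    | cond_true hb h => exact ⟨fun _ => ⟨_, _, h, hq⟩, fun hn => absurd hb hn⟩
    | cond_false hb h => exact ⟨fun hn => absurd hn hb, fun _ => ⟨_, _, h, hq⟩⟩
  · rintro ⟨h₁, h₂⟩
    by_cases hb : b.Holds s
    · obtain ⟨t, s', h, hq⟩ := h₁ hb
      exact ⟨_, _, .cond_true hb h, hq⟩
    · obtain ⟨t, s', h, hq⟩ := h₂ hb
      exact ⟨_, _, .cond_false hb h, hq⟩

/-- The registers that a program may write. -/
def Prog.writes : Prog → List ℕ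
  | .skip => []
  | .const x _ => [x]
  | .copy x _ => [x]
  | .arith _ x _ _ => [x]
  | .load x _ => [x]
  | .store _ _ => []
  | .seq p q => p.writes ++ q.writes
  | .cond _ p q => p.writes ++ q.writes
  | .loop _ p => p.writes

theorem Exec.reg_eq {p : Prog} {s s' : State} {t : ℕ} (h : Exec W p s t s') :
    ∀ x, x ∉ p.writes → s'.reg x = s.reg x := by
  induction h <;> simp_all [Prog.writes]

/-- A derivation of `wp` may use that registers which are not written keep their contents. -/
theorem wp_frame {p : Prog} (h : wp W p Q s) :
    wp W p (fun t s' => Q t s' ∧ ∀ x, x ∉ p.writes → s'.reg x = s.reg x) s := by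
  obtain ⟨t, s', h, hq⟩ := h
  exact ⟨t, s', h, hq, h.reg_eq⟩

/-- `if b then p`. -/
abbrev when (b : Test) (p : Prog) : Prog := .cond b p .skip

/-- `for i := 0 to m - 1 do body`, where `i` and `m` are registers and register `2` contains `1`. -/
def forLoop (i m : ℕ) (body : Prog) : Prog :=
  .seq (.const i 0) (.loop (.lt i m) (.seq body (.arith .add i i 2)))

/-- The registers in use do not interfere with the control of the loop. -/
abbrev LoopOk (i m : ℕ) (body : Prog) : Prop :=
  i ≠ m ∧ i ≠ 2 ∧ i ∉ body.writes ∧ m ∉ body.writes ∧ 2 ∉ body.writes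

theorem wp_forLoop {i m T : ℕ} {body : Prog} (I : ℕ → State → Prop)
    (hc : LoopOk i m body) (hone : s.reg 2 = 1) (hW : s.reg m < W) (h0 : I 0 (s.setReg i 0))
    (hstep : ∀ j s₁, j < s.reg m → s₁.reg i = j →
      (∀ x, x ∉ body.writes → x ≠ i → s₁.reg x = s.reg x) → I j s₁ →
      wp W body (fun t s₂ => t ≤ T ∧ I (j + 1) (s₂.setReg i (j + 1))) s₁) :
    wp W (forLoop i m body) (fun t s' => t ≤ s.reg m * (T + 2) + 2 ∧ I (s.reg m) s' ∧
      ∀ x, x ∉ body.writes → x ≠ i → s'.reg x = s.reg x) s := by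
  obtain ⟨him, hi2, hib, hmb, h2b⟩ := hc
  have key : ∀ r j s₁, j + r = s.reg m → s₁.reg i = j →
      (∀ x, x ∉ body.writes → x ≠ i → s₁.reg x = s.reg x) → I j s₁ →
      ∃ t s', Exec W (.loop (.lt i m) (.seq body (.arith .add i i 2))) s₁ t s' ∧
        t ≤ r * (T + 2) + 1 ∧ I (s.reg m) s' ∧
        ∀ x, x ∉ body.writes → x ≠ i → s'.reg x = s.reg x := by
    intro r
    induction r with
    | zero =>
      intro j s₁ hj hi hfr hI
      refine ⟨1, s₁, ?_, by omega, ?_, hfr⟩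
      · constructor
        rw [Test.holds_lt, hi, hfr m hmb him.symm]
        omega
      · rwa [← hj]
    | succ r ih =>
      intro j s₁ hj hi hfr hI
      obtain ⟨t, s₂, hex, ht, hI₂⟩ := hstep j s₁ (by omega) hi hfr hI
      have hreg := hex.reg_eq
      have h2 : s₂.reg 2 = 1 := by rw [hreg 2 h2b, hfr 2 h2b hi2.symm, hone]
      have hi₂ : s₂.reg i = j := by rw [hreg i hib, hi]
      obtain ⟨t', s', hex', ht', hI', hfr'⟩ := ih (j + 1) (s₂.setReg i (j + 1)) (by omega)
        (by simp) (fun x hx hxi => by simp [hxi, hreg x hx, hfr x hx hxi]) hI₂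
      refine ⟨1 + (t + 1) + t', s', .loop_step ?_ (.seq hex ?_) hex', ?_, hI', hfr'⟩
      · rw [Test.holds_lt, hi, hfr m hmb him.symm]
        omega
      · have := Exec.arith (W := W) s₂ .add i i 2 (by simp only [Op.eval, h2, hi₂]; omega)
        simpa only [Op.eval, h2, hi₂] using this
      · rw [Nat.succ_mul]
        omega
  obtain ⟨t, s', hex, ht, hI, hfr⟩ := key (s.reg m) 0 (s.setReg i 0) (by omega) (by simp)
    (fun x _ hx => by simp [hx]) h0
  exact ⟨_, s', .seq (.const s i 0 (by omega)) hex, by omega, hI, hfr⟩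

end RAM

/-! ### The algorithm as a mathematical function -/

namespace PackingColoring

/-- One relaxation of the matrix stored row by row in `m`: the index `q` encodes a triple
`(u, v, w)`, and the entry `(u, v)` is replaced by the sum of the entries `(u, w)` and `(w, v)` if
that is smaller. -/
def relaxStep (n q : ℕ) (m : ℕ → ℕ) : ℕ → ℕ :=
  if m (q / n / n % n * n + q % n) + m (q % n * n + q / n % n) <
      m (q / n / n % n * n + q / n % n) then
    Function.update m (q / n / n % n * n + q / n % n)
      (m (q / n / n % n * n + q % n) + m (q % n * n + q / n % n))
  else m

/-- The matrix after the relaxations with the indices below `q`. -/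
def relax (n : ℕ) (m : ℕ → ℕ) : ℕ → ℕ → ℕ
  | 0 => m
  | q + 1 => relaxStep n q (relax n m q)

/-- The matrix from which the relaxations start: `0` on the diagonal, `1` for adjacent vertices,
and the bound `d` on the diameter elsewhere. -/
def initMatrix (n d : ℕ) (m : ℕ → ℕ) (a : ℕ) : ℕ :=
  if a / n = a % n then 0 else if m a = 1 then 1 else d

/-- The index `q` encodes the slot number `q % d` of the color `q / d`. Only colors at least `2` are
given slots, and color `c` gets `(d - 2) / (c - 1) + 1` of them. -/
abbrev IsSlot (d q : ℕ) : Prop := 1 < q / d ∧ (q / d - 1) * (q % d) < d - 1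

/-- The colors of the slots with index below `q`. -/
def slotColors (d q : ℕ) : List ℕ := ((List.range q).filter (IsSlot d ·)).map (· / d)

variable {n : ℕ}

/-- Give the color `c` to the vertex `g`, if there is such a vertex, if it has no color so far and
if this is compatible with the vertices that have the color `c` already. The state consists of the
coloring, where `0` stands for no color, and of an upper bound on the colors in use. -/
def fillStep (D : Fin n → Fin n → ℕ) (c g : ℕ) (p : (Fin n → ℕ) × ℕ) : (Fin n → ℕ) × ℕ :=
  if h : g < n then
    if p.1 ⟨g, h⟩ = 0 ∧ ∀ u, p.1 u = c → c < D u ⟨g, h⟩ then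
      (Function.update p.1 ⟨g, h⟩ c, max p.2 c)
    else p
  else p

/-- The digits of `N` to the base `n + 1` name the vertices to be tried for the successive slots;
the digit `n` leaves the slot empty. -/
def fill (D : Fin n → Fin n → ℕ) (S : ℕ → ℕ) (N : ℕ) : ℕ → (Fin n → ℕ) × ℕ
  | 0 => (fun _ => 0, 1)
  | j + 1 => fillStep D (S j) (N / (n + 1) ^ j % (n + 1)) (fill D S N j)

/-- The neighbors of `v` among the undecided vertices form a clique. -/
abbrev IsSimplicial (D : Fin n → Fin n → ℕ) (col : Fin n → ℕ) (v : Fin n) : Prop :=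
  ∀ a b, col a = 0 → col b = 0 → D v a = 1 → D v b = 1 → D a b ≤ 1

/-- If `v` is undecided and simplicial, give it the color `1`, and mark its undecided neighbors with
`d` as not receiving a color below `d`. -/
def misStep (D : Fin n → Fin n → ℕ) (d : ℕ) (col : Fin n → ℕ) (v : Fin n) : Fin n → ℕ :=
  if col v = 0 ∧ IsSimplicial D col v then
    fun a => if a = v then 1 else if col a = 0 ∧ D v a = 1 then d else col a
  else col

/-- The result of `q` greedy steps, which go through the vertices cyclically. -/
def mis [NeZero n] (D : Fin n → Fin n → ℕ) (d : ℕ) (col : Fin n → ℕ) : ℕ → Fin n → ℕ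
  | 0 => col
  | q + 1 => misStep D d (mis D d col q) (Fin.ofNat n q)

/-- The number of colors used by the coloring with number `N`: the vertices marked with `d` get
pairwise distinct colors from `d` on. -/
def result [NeZero n] (D : Fin n → Fin n → ℕ) (d E : ℕ) (S : ℕ → ℕ) (N : ℕ) : ℕ :=
  let p := fill D S N E
  let U := (Finset.univ.filter fun v => mis D d p.1 (n * n) v = d).card
  if U = 0 then p.2 else d - 1 + U

/-- The smallest of `n` and of the results for the numbers below `N`. -/
def best [NeZero n] (D : Fin n → Fin n → ℕ) (d E : ℕ) (S : ℕ → ℕ) : ℕ → ℕ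
  | 0 => n
  | N + 1 => min (best D d E S N) (result D d E S N)

end PackingColoring

/-! ### The program -/

namespace RAM

open PackingColoring

/-! The registers `0`, …, `7`, `11` and `12` are constants, see `Env` below. Registers `8` and `9`
hold the number `E` of slots and `(n + 1) ^ E`, register `10` the smallest number of colors found so
far, and register `13` the number of the current coloring. In memory the matrix is followed, from
the address `n * n` on, by the colors of the `n` vertices and then by the colors of the slots. -/

/-- Compute the matrix from which the relaxations start. -/
def initMatrixProg : Prog :=
  forLoop 20 3
    (.seq (.arith .div 21 20 0) <| .seq (.arith .mod 22 20 0) <|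
      .cond (.eq 21 22) (.store 20 6) <|
        .seq (.load 23 20) <| .cond (.eq 23 2) .skip (.store 20 1))

/-- One relaxation, see `relaxStep`; the registers `21`, `22`, `23` are `w`, `u`, `v`. -/
def relaxBody : Prog :=
  .seq (.arith .mod 21 20 0) <| .seq (.arith .div 22 20 0) <| .seq (.arith .mod 23 22 0) <|
  .seq (.arith .div 22 22 0) <| .seq (.arith .mod 22 22 0) <| .seq (.arith .mul 24 22 0) <|
  .seq (.arith .add 25 24 21) <| .seq (.load 25 25) <| .seq (.arith .mul 26 21 0) <|
  .seq (.arith .add 26 26 23) <| .seq (.load 26 26) <| .seq (.arith .add 25 25 26) <|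
  .seq (.arith .add 24 24 23) <| .seq (.load 26 24) <| when (.lt 25 26) (.store 24 25)

/-- Turn the initial matrix into the distance matrix. -/
def relaxProg : Prog := forLoop 20 11 relaxBody

/-- Write the colors of the slots to the memory, and compute their number `E` and
`(n + 1) ^ E`. -/
def slotsProg : Prog :=
  forLoop 20 12
    (.seq (.arith .div 21 20 1) <| .seq (.arith .mod 22 20 1) <| when (.lt 2 21) <|
      .seq (.arith .sub 23 21 2) <| .seq (.arith .mul 23 23 22) <| when (.lt 23 7) <|
        .seq (.arith .add 24 4 8) <| .seq (.store 24 21) <| .seq (.arith .add 8 8 2) <|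
        .arith .mul 9 9 5)

/-- Remove all colors. -/
def clearProg : Prog := forLoop 20 0 (.seq (.arith .add 21 3 20) (.store 21 6))

/-- Set register `25` to `0` if the vertex in register `22` may get the color in register `21`, and to
`1` otherwise. -/
def checkProg : Prog :=
  .seq (.const 25 0) <| forLoop 26 0
    (.seq (.arith .add 27 3 26) <| .seq (.load 27 27) <| when (.eq 27 21) <|
      .seq (.arith .mul 28 26 0) <| .seq (.arith .add 28 28 22) <| .seq (.load 28 28) <|
      .cond (.lt 21 28) .skip (.const 25 1))

/-- Process one slot, see `fillStep`. Register `14` holds the digits that are still to be read, and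
register `15` bounds the colors in use. -/
def fillBody : Prog :=
  .seq (.arith .add 21 4 20) <| .seq (.load 21 21) <| .seq (.arith .mod 22 14 5) <|
  .seq (.arith .div 14 14 5) <| when (.lt 22 0) <|
    .seq (.arith .add 23 3 22) <| .seq (.load 24 23) <| when (.eq 24 6) <|
      .seq checkProg <| when (.eq 25 6) <|
        .seq (.store 23 21) <| when (.lt 15 21) (.copy 15 21)

/-- Color the vertices named by the digits of the number in register `13`. -/
def fillProg : Prog :=
  .seq (.copy 14 13) <| .seq (.copy 15 2) <| forLoop 20 8 fillBody

/-- Set register `25` to `0` if the vertex in register `17` is simplicial, and to `1` otherwise. -/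
def simplicialProg : Prog :=
  .seq (.const 25 0) <| forLoop 26 3
    (.seq (.arith .div 27 26 0) <| .seq (.arith .mod 28 26 0) <| .seq (.load 29 26) <|
      when (.lt 2 29) <|
      .seq (.arith .mul 30 17 0) <| .seq (.arith .add 31 30 27) <| .seq (.load 31 31) <|
      when (.eq 31 2) <|
      .seq (.arith .add 31 30 28) <| .seq (.load 31 31) <| when (.eq 31 2) <|
      .seq (.arith .add 31 3 27) <| .seq (.load 31 31) <| when (.eq 31 6) <|
      .seq (.arith .add 31 3 28) <| .seq (.load 31 31) <| when (.eq 31 6) <| .const 25 1)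

/-- Mark the undecided neighbors of the vertex in register `17`. -/
def killProg : Prog :=
  forLoop 26 0
    (.seq (.arith .add 27 3 26) <| .seq (.load 28 27) <| when (.eq 28 6) <|
      .seq (.arith .mul 29 17 0) <| .seq (.arith .add 29 29 26) <| .seq (.load 29 29) <|
      when (.eq 29 2) (.store 27 1))

/-- One greedy step, see `misStep`. -/
def misBody : Prog :=
  .seq (.arith .mod 17 16 0) <| .seq (.arith .add 18 3 17) <| .seq (.load 19 18) <|
    when (.eq 19 6) <| .seq simplicialProg <| when (.eq 25 6) <| .seq killProg (.store 18 2)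

/-- Color a maximum independent set of undecided vertices with `1`. -/
def misProg : Prog := forLoop 16 3 misBody

/-- Count the marked vertices. -/
def countProg : Prog :=
  .seq (.const 21 0) <| forLoop 20 0
    (.seq (.arith .add 22 3 20) <| .seq (.load 22 22) <| when (.eq 22 1) <| .arith .add 21 21 2)

/-- Compute the number of colors and compare it with the best one so far. -/
def updateProg : Prog :=
  .seq (.cond (.eq 21 6) (.copy 22 15) (.arith .add 22 7 21)) <| when (.lt 22 10) (.copy 10 22)

/-- Evaluate one coloring, see `result`. -/
def mainBody : Prog :=
  .seq clearProg <| .seq fillProg <| .seq misProg <| .seq countProg updateProg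

/-- Set the constants, and initialize the registers `8`, `9`, `10`. -/
def setupProg : Prog :=
  .seq (.arith .mul 3 0 0) <| .seq (.arith .add 4 3 0) <| .seq (.arith .add 5 0 2) <|
  .seq (.const 6 0) <| .seq (.arith .sub 7 1 2) <| .seq (.const 8 0) <| .seq (.copy 9 2) <|
  .seq (.copy 10 0) <| .seq (.arith .mul 11 3 0) <| .seq (.arith .mul 11 11 1) <|
  .arith .mul 12 1 1

/-- Compute the packing chromatic number. For `d = 1` the graph is complete. -/
def packingProg : Prog :=
  .seq (.const 2 1) <| .cond (.eq 1 2) .skip <|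
    .seq setupProg <| .seq initMatrixProg <| .seq relaxProg <| .seq slotsProg <|
    .seq (forLoop 13 9 mainBody) (.copy 0 10)

/-! ### Correctness of the program -/

/-- The contents of the registers that stay fixed after the set-up. -/
structure Env (n d : ℕ) (s : State) : Prop where
  r0 : s.reg 0 = n
  r1 : s.reg 1 = d
  r2 : s.reg 2 = 1
  r3 : s.reg 3 = n * n
  r4 : s.reg 4 = n * n + n
  r5 : s.reg 5 = n + 1
  r6 : s.reg 6 = 0
  r7 : s.reg 7 = d - 1
  r11 : s.reg 11 = n * n * n * d
  r12 : s.reg 12 = d * d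

theorem Env.congr {n d : ℕ} {s s' : State} (h : Env n d s)
    (hf : ∀ x ∈ [0, 1, 2, 3, 4, 5, 6, 7, 11, 12], s'.reg x = s.reg x) : Env n d s' := by
  simp only [List.forall_mem_cons] at hf
  obtain ⟨h0, h1, h2, h3, h4, h5, h6, h7, h11, h12, -⟩ := hf
  constructor
  all_goals simp only [*, h.r0, h.r1, h.r2, h.r3, h.r4, h.r5, h.r6, h.r7, h.r11, h.r12]

theorem Env.frame {n d i : ℕ} {s s' : State} {l : List ℕ} (h : Env n d s)
    (hf : ∀ x, x ∉ l → x ≠ i → s'.reg x = s.reg x)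
    (hl : ∀ x ∈ [0, 1, 2, 3, 4, 5, 6, 7, 11, 12], x ∉ l ∧ x ≠ i) : Env n d s' :=
  h.congr fun x hx => hf x (hl x hx).1 (hl x hx).2

/-- The layout of the memory: the distance matrix, the coloring and the slots. -/
structure Rep {n : ℕ} (d E : ℕ) (D : Fin n → Fin n → ℕ) (S : ℕ → ℕ) (col : Fin n → ℕ)
    (m : ℕ → ℕ) : Prop where
  dist : ∀ u v : Fin n, m (u * n + v) = D u v
  col : ∀ v : Fin n, m (n * n + v) = col v
  slot : ∀ j < E, m (n * n + n + j) = S j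
  le : ∀ a, m a ≤ d

theorem index_lt {n u v : ℕ} (hu : u < n) (hv : v < n) : u * n + v < n * n := by
  calc u * n + v < (u + 1) * n := by rw [Nat.succ_mul]; omega
    _ ≤ n * n := Nat.mul_le_mul_right _ hu

theorem Rep.update {n d E : ℕ} {D : Fin n → Fin n → ℕ} {S : ℕ → ℕ} {col : Fin n → ℕ}
    {m : ℕ → ℕ} (h : Rep d E D S col m) (v : Fin n) {c : ℕ} (hc : c ≤ d) :
    Rep d E D S (Function.update col v c) (Function.update m (n * n + v) c) := by
  refine ⟨fun a b => ?_, fun a => ?_, fun j hj => ?_, fun a => ?_⟩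
  · have := index_lt a.2 b.2
    rw [Function.update_of_ne (by omega), h.dist]
  · by_cases hav : a = v
    · subst hav
      simp
    · have : (a : ℕ) ≠ v := fun h => hav (Fin.ext h)
      rw [Function.update_of_ne (by omega), Function.update_of_ne hav, h.col]
  · have := v.2
    rw [Function.update_of_ne (by omega), h.slot j hj]
  · rw [Function.update_apply]
    split_ifs
    exacts [hc, h.le a]

variable {W n d : ℕ} {s : State}

theorem wp_initMatrixProg (he : Env n d s) (hn : 0 < n) (hd : 0 < d) (hm : ∀ a, s.mem a ≤ d)
    (hW : n * n + n + d < W) :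
    wp W initMatrixProg (fun t s' => t ≤ n * n * 9 + 2 ∧
      (s'.mem = fun a => if a < n * n then initMatrix n d s.mem a else s.mem a) ∧
      ∀ x, x ∉ initMatrixProg.writes → s'.reg x = s.reg x) s := by
  have key := wp_forLoop (W := W) (i := 20) (m := 3) (T := 7) (s := s)
    (body := .seq (.arith .div 21 20 0) <| .seq (.arith .mod 22 20 0) <|
      .cond (.eq 21 22) (.store 20 6) <|
        .seq (.load 23 20) <| .cond (.eq 23 2) .skip (.store 20 1))
    (fun j s' => s'.mem = fun a => if a < j then initMatrix n d s.mem a else s.mem a)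
    (by decide) he.r2 (by rw [he.r3]; omega) (by simp) ?_
  · refine wp_mono (wp_frame key) fun t s' ⟨⟨h₁, h₂, _⟩, h₃⟩ => ⟨?_, ?_, h₃⟩
    · rwa [he.r3] at h₁
    · rwa [he.r3] at h₂
  · intro j s₁ hj hi hfr hI
    rw [he.r3] at hj
    have e := he.frame hfr (by decide)
    have h1 : j / n ≤ j := Nat.div_le_self _ _
    have h2 : j % n ≤ j := Nat.mod_le _ _
    have h3 : s.mem j ≤ d := hm j
    have upd : ∀ c, initMatrix n d s.mem j = c →
        Function.update s₁.mem j c =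
          fun a => if a < j + 1 then initMatrix n d s.mem a else s.mem a := by
      intro c hc
      funext a
      rw [hI, Function.update_apply]
      by_cases haj : a = j
      · simp [haj, hc]
      · have : a < j + 1 ↔ a < j := by omega
        simp [haj, this]
    have hj' : s₁.mem j = s.mem j := by simp [hI]
    simp only [wp_seq, wp_arith, wp_cond, wp_store, wp_load, wp_skip, Op.eval, State.setReg_reg,
      State.setReg_mem, State.setMem_mem, hi, e.r0, e.r1, e.r2, e.r6, Test.holds_eq, hj',
      Nat.reduceEqDiff, if_true, if_false]
    refine ⟨by omega, by omega, fun h => ⟨by norm_num, ?_⟩, fun h => ⟨by omega, fun h' =>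
      ⟨by norm_num, ?_⟩, fun h' => ⟨by norm_num, ?_⟩⟩⟩
    · exact upd 0 (by simp [initMatrix, h])
    · rw [← upd 1 (by simp [initMatrix, h, h']), eq_comm, Function.update_eq_self_iff, hj', h']
    · exact upd d (by simp [initMatrix, h, h'])

theorem relaxStep_le {n d q : ℕ} {m : ℕ → ℕ} (hm : ∀ a, m a ≤ d) (a : ℕ) :
    relaxStep n q m a ≤ d := by
  unfold relaxStep
  split_ifs with h
  · rw [Function.update_apply]
    split_ifs
    · exact h.le.trans (hm _)
    · exact hm a
  · exact hm a

theorem relax_le {n d : ℕ} {m : ℕ → ℕ} (hm : ∀ a, m a ≤ d) (q a : ℕ) : relax n m q a ≤ d := by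
  induction q generalizing a with
  | zero => exact hm a
  | succ q ih => exact relaxStep_le ih a

theorem wp_relaxProg (he : Env n d s) (hn : 0 < n) (hm : ∀ a, s.mem a ≤ d)
    (hW : n * n * n * d + n * n + n + d + d < W) :
    wp W relaxProg (fun t s' => t ≤ n * n * n * d * 18 + 2 ∧
      s'.mem = relax n s.mem (n * n * n * d) ∧
      ∀ x, x ∉ relaxProg.writes → s'.reg x = s.reg x) s := by
  have key := wp_forLoop (W := W) (i := 20) (m := 11) (T := 16) (s := s) (body := relaxBody)
    (fun j s' => s'.mem = relax n s.mem j)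
    (by decide) he.r2 (by rw [he.r11]; omega) (by simp [relax]) ?_
  · refine wp_mono (wp_frame key) fun t s' ⟨⟨h₁, h₂, _⟩, h₃⟩ => ⟨?_, ?_, h₃⟩
    · rwa [he.r11] at h₁
    · rwa [he.r11] at h₂
  · intro j s₁ hj hi hfr hI
    rw [he.r11] at hj
    have e := he.frame hfr (by decide)
    have hle : ∀ a, s₁.mem a ≤ d := by
      rw [hI]
      exact relax_le hm j
    have hu : j / n / n % n < n := Nat.mod_lt _ hn
    have hv : j / n % n < n := Nat.mod_lt _ hn
    have hw : j % n < n := Nat.mod_lt _ hn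
    have h1 := index_lt hu hv
    have h2 := index_lt hu hw
    have h3 := index_lt hw hv
    have h4 : j / n ≤ j := Nat.div_le_self _ _
    have h5 : j / n / n ≤ j / n := Nat.div_le_self _ _
    have l1 := hle (j / n / n % n * n + j / n % n)
    have l2 := hle (j / n / n % n * n + j % n)
    have l3 := hle (j % n * n + j / n % n)
    simp only [relax, relaxStep, ← hI]
    simp only [relaxBody, wp_seq, wp_arith, wp_cond, wp_store, wp_load, wp_skip, Op.eval,
      State.setReg_reg, State.setReg_mem, State.setMem_mem, hi, e.r0, Test.holds_lt,
      Nat.reduceEqDiff, if_true, if_false]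
    refine ⟨by omega, by omega, by omega, by omega, by omega, by omega, by omega, by omega,
      by omega, by omega, by omega, by omega, by omega, by omega, fun h => ⟨by norm_num, ?_⟩,
      fun h => ⟨by norm_num, ?_⟩⟩
    · rw [if_pos h]
    · rw [if_neg h]

theorem slotColors_succ (d q : ℕ) : slotColors d (q + 1) =
    if IsSlot d q then slotColors d q ++ [q / d] else slotColors d q := by
  unfold slotColors
  rw [List.range_succ, List.filter_append, List.map_append]
  split_ifs with h <;> simp [h]

theorem slotColors_length_le (d : ℕ) {q r : ℕ} (h : q ≤ r) :
    (slotColors d q).length ≤ (slotColors d r).length := by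
  induction r, h using Nat.le_induction with
  | base => rfl
  | succ r _ ih =>
    rw [slotColors_succ]
    split_ifs
    · rw [List.length_append]
      omega
    · exact ih

theorem wp_slotsProg (he : Env n d s) (hd : 0 < d) (hm : ∀ a, s.mem a ≤ d) (h8 : s.reg 8 = 0)
    (h9 : s.reg 9 = 1)
    (hW : n * n + n + d * d + (n + 1) ^ (slotColors d (d * d)).length + 2 < W) :
    wp W slotsProg (fun t s' => t ≤ d * d * 13 + 2 ∧
      s'.reg 8 = (slotColors d (d * d)).length ∧
      s'.reg 9 = (n + 1) ^ (slotColors d (d * d)).length ∧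
      (∀ a < n * n + n, s'.mem a = s.mem a) ∧
      (∀ j < (slotColors d (d * d)).length,
        s'.mem (n * n + n + j) = (slotColors d (d * d)).getD j 0) ∧
      (∀ a, s'.mem a ≤ d) ∧
      ∀ x, x ∉ slotsProg.writes → s'.reg x = s.reg x) s := by
  have key := wp_forLoop (W := W) (i := 20) (m := 12) (T := 11) (s := s)
    (body := .seq (.arith .div 21 20 1) <| .seq (.arith .mod 22 20 1) <| when (.lt 2 21) <|
      .seq (.arith .sub 23 21 2) <| .seq (.arith .mul 23 23 22) <| when (.lt 23 7) <|
        .seq (.arith .add 24 4 8) <| .seq (.store 24 21) <| .seq (.arith .add 8 8 2) <|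
        .arith .mul 9 9 5)
    (fun j s' => s'.reg 8 = (slotColors d j).length ∧
      s'.reg 9 = (n + 1) ^ (slotColors d j).length ∧
      (∀ a < n * n + n, s'.mem a = s.mem a) ∧
      (∀ i < (slotColors d j).length, s'.mem (n * n + n + i) = (slotColors d j).getD i 0) ∧
      ∀ a, s'.mem a ≤ d)
    (by decide) he.r2 (by rw [he.r12]; omega) (by simp [slotColors, h8, h9, hm]) ?_
  · refine wp_mono (wp_frame key) fun t s' ⟨⟨h₁, h₂, _⟩, h₃⟩ => ?_
    rw [he.r12] at h₁ h₂
    exact ⟨h₁, h₂.1, h₂.2.1, h₂.2.2.1, h₂.2.2.2.1, h₂.2.2.2.2, h₃⟩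
  · rintro j s₁ hj hi hfr ⟨i8, i9, ilow, islot, ile⟩
    rw [he.r12] at hj
    have e := he.frame (l := [21, 22, 23, 24, 8, 9]) (i := 20) (s' := s₁)
      (fun x hx hx' => hfr x (by simpa [Prog.writes] using hx) hx') (by decide)
    have h1 : j / d < d := Nat.div_lt_of_lt_mul hj
    have h2 : j % d < d := Nat.mod_lt _ hd
    have hdd : d ≤ d * d := Nat.le_mul_self d
    have h3 : (j / d - 1) * (j % d) ≤ d * d := Nat.mul_le_mul (by omega) h2.le
    have hlen := slotColors_length_le d (Nat.succ_le_of_lt hj)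
    have hpow : (n + 1) ^ (slotColors d (j + 1)).length ≤
        (n + 1) ^ (slotColors d (d * d)).length := Nat.pow_le_pow_right (by omega) hlen
    have hE : (slotColors d (d * d)).length ≤ d * d := by
      simpa [slotColors] using List.length_filter_le (IsSlot d ·) (List.range (d * d))
    have hsucc := slotColors_succ d j
    simp only [wp_seq, wp_arith, wp_cond, wp_store, wp_skip, Op.eval,
      State.setReg_reg, State.setReg_mem, State.setMem_mem, State.setMem_reg, hi, e.r1, e.r2, e.r4,
      e.r5, e.r7, i8, i9, Test.holds_lt, Nat.reduceEqDiff, if_true, if_false]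
    refine ⟨by omega, by omega, fun h => ⟨by omega, by omega, fun h' => ?_, fun h' => ?_⟩,
      fun h => ?_⟩
    · have hs : IsSlot d j := ⟨h, h'⟩
      rw [if_pos hs] at hsucc
      rw [hsucc, List.length_append, List.length_singleton] at hpow hlen
      rw [pow_succ] at hpow
      rw [hsucc]
      refine ⟨by omega, by omega, by omega, by norm_num, by simp, by simp [pow_succ], ?_, ?_, ?_⟩
      · intro a ha
        rw [Function.update_of_ne (by omega), ilow a ha]
      · intro i hi
        rw [List.length_append, List.length_singleton] at hi
        rcases Nat.lt_succ_iff_lt_or_eq.1 hi with hi | hi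
        · rw [Function.update_of_ne (by omega), islot i hi, List.getD_append _ _ _ _ hi]
        · subst hi
          simp
      · intro a
        rw [Function.update_apply]
        split_ifs
        · exact h1.le
        · exact ile a
    · have hs : ¬ IsSlot d j := fun hs => h' hs.2
      rw [if_neg hs] at hsucc
      rw [hsucc]
      exact ⟨by norm_num, rfl, rfl, ilow, islot, ile⟩
    · have hs : ¬ IsSlot d j := fun hs => h hs.1
      rw [if_neg hs] at hsucc
      rw [hsucc]
      exact ⟨by norm_num, rfl, rfl, ilow, islot, ile⟩

end RAM

/-! ### Correctness of the main loop -/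

namespace RAM

open PackingColoring

variable {W n d E : ℕ} {s : State} {D : Fin n → Fin n → ℕ} {S : ℕ → ℕ} {col : Fin n → ℕ}

theorem wp_clearProg (he : Env n d s) (hr : Rep d E D S col s.mem)
    (hW : n * n + n < W) :
    wp W clearProg (fun t s' => t ≤ n * 4 + 2 ∧ Rep d E D S (fun _ => 0) s'.mem ∧
      ∀ x, x ∉ clearProg.writes → s'.reg x = s.reg x) s := by
  have key := wp_forLoop (W := W) (i := 20) (m := 0) (T := 2) (s := s)
    (body := .seq (.arith .add 21 3 20) (.store 21 6))
    (fun j s' => Rep d E D S (fun v => if v.1 < j then 0 else col v) s'.mem)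
    (by decide) he.r2 (by rw [he.r0]; omega) (by simpa using hr) ?_
  · refine wp_mono (wp_frame key) fun t s' ⟨⟨h₁, h₂, _⟩, h₃⟩ => ⟨?_, ?_, h₃⟩
    · rwa [he.r0] at h₁
    · simpa [he.r0] using h₂
  · intro j s₁ hj hi hfr hI
    rw [he.r0] at hj
    have e := he.frame hfr (by decide)
    simp only [wp_seq, wp_arith, wp_store, Op.eval, State.setReg_reg, State.setReg_mem,
      State.setMem_mem, hi, e.r3, e.r6, Nat.reduceEqDiff, if_true, if_false]
    refine ⟨by omega, by norm_num, ?_⟩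
    convert hI.update ⟨j, hj⟩ (Nat.zero_le d) using 1
    funext v
    by_cases hv : v = ⟨j, hj⟩
    · simp [hv]
    · have : (v : ℕ) ≠ j := fun h => hv (Fin.ext h)
      rw [Function.update_of_ne hv]
      congr 1
      rw [eq_iff_iff]
      omega

theorem wp_checkProg (he : Env n d s) (hr : Rep d E D S col s.mem) (hd : 0 < d)
    {v : Fin n} {c : ℕ} (hv : s.reg 22 = v) (hc : s.reg 21 = c) (hW : n * n + n + d < W) :
    wp W checkProg (fun t s' => t ≤ n * 10 + 3 ∧ s'.mem = s.mem ∧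
      (s'.reg 25 = 0 ↔ ∀ u, col u = c → c < D u v) ∧
      ∀ x, x ∉ checkProg.writes → s'.reg x = s.reg x) s := by
  have key := wp_forLoop (W := W) (i := 26) (m := 0) (T := 8) (s := s.setReg 25 0)
    (body := .seq (.arith .add 27 3 26) <| .seq (.load 27 27) <| when (.eq 27 21) <|
      .seq (.arith .mul 28 26 0) <| .seq (.arith .add 28 28 22) <| .seq (.load 28 28) <|
      .cond (.lt 21 28) .skip (.const 25 1))
    (fun j s' => s'.mem = s.mem ∧
      (s'.reg 25 = 0 ↔ ∀ u : Fin n, u.1 < j → col u = c → c < D u v))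
    (by decide) (by simp [he.r2]) (by simp [he.r0]; omega) (by simp) ?_
  · rw [checkProg]
    refine wp_mono (wp_frame (wp_const_seq (by omega) key))
      fun t s' ⟨⟨t', ht, h₁, h₂, _⟩, h₃⟩ => ⟨?_, ?_, ?_, h₃⟩
    · simp only [State.setReg_reg, Nat.reduceEqDiff, if_false, he.r0] at h₁
      omega
    · exact h₂.1
    · simpa [he.r0] using h₂.2
  · rintro j s₁ hj hi hfr ⟨hm, hI⟩
    simp only [State.setReg_reg, Nat.reduceEqDiff, if_false, he.r0] at hj
    have hfr' : ∀ x, x ∉ [27, 28, 25] → x ≠ 26 → s₁.reg x = s.reg x := fun x hx hx' => by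
      rw [hfr x (by simpa [Prog.writes] using hx) hx', State.setReg_reg, if_neg]
      rintro rfl
      simp at hx
    have e := he.frame hfr' (by decide)
    have e21 : s₁.reg 21 = c := by rw [hfr' 21 (by decide) (by decide), hc]
    have e22 : s₁.reg 22 = v := by rw [hfr' 22 (by decide) (by decide), hv]
    have hix := index_lt hj v.2
    have l1 := hr.le (n * n + j)
    have l2 := hr.le (j * n + v)
    have hcol := hr.col ⟨j, hj⟩
    have hdist := hr.dist ⟨j, hj⟩ v
    simp only at hcol hdist
    have split : (∀ u : Fin n, u.1 < j + 1 → col u = c → c < D u v) ↔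
        (∀ u : Fin n, u.1 < j → col u = c → c < D u v) ∧
          (col ⟨j, hj⟩ = c → c < D ⟨j, hj⟩ v) := by
      constructor
      · exact fun h => ⟨fun u hu => h u (by omega), h _ (Nat.lt_succ_self j)⟩
      · rintro ⟨h1, h2⟩ u hu
        rcases Nat.lt_succ_iff_lt_or_eq.1 hu with hu | hu
        · exact h1 u hu
        · have : u = ⟨j, hj⟩ := Fin.ext hu
          rwa [this]
    simp only [wp_seq, wp_arith, wp_cond, wp_const, wp_load, wp_skip, Op.eval, State.setReg_reg,
      State.setReg_mem, hi, e.r0, e.r3, e21, e22, hm, hcol, hdist, Test.holds_lt, Test.holds_eq,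
      Nat.reduceEqDiff, if_true, if_false, split, hI]
    rw [hcol] at l1
    rw [hdist] at l2
    refine ⟨by omega, by omega, fun h => ⟨by omega, by omega, by omega, fun h' => ?_,
      fun h' => ⟨by omega, ?_⟩⟩, fun h => ?_⟩
    · exact ⟨by norm_num, trivial, by tauto⟩
    · exact ⟨by norm_num, trivial, by simp [h, h']⟩
    · exact ⟨by norm_num, trivial, by tauto⟩

theorem wp_fillProg (he : Env n d s) (hr : Rep d E D S (fun _ => 0) s.mem) (hd : 0 < d)
    (hn : 0 < n) (h8 : s.reg 8 = E) (hW : n * n + n + d + E + s.reg 13 + 1 < W) :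
    wp W fillProg (fun t s' => t ≤ E * (n * 10 + 22) + 4 ∧
      Rep d E D S (fill D S (s.reg 13) E).1 s'.mem ∧ s'.reg 15 = (fill D S (s.reg 13) E).2 ∧
      (fill D S (s.reg 13) E).2 ≤ d ∧
      ∀ x, x ∉ fillProg.writes → s'.reg x = s.reg x) s := by
  set N := s.reg 13 with hN
  have key := wp_forLoop (W := W) (i := 20) (m := 8) (T := n * 10 + 20)
    (s := (s.setReg 14 N).setReg 15 1) (body := fillBody)
    (fun j s' => Rep d E D S (fill D S N j).1 s'.mem ∧ s'.reg 15 = (fill D S N j).2 ∧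
      (fill D S N j).2 ≤ d ∧ s'.reg 14 = N / (n + 1) ^ j)
    (by decide) (by simp [he.r2]) (by simp [h8]; omega) (by simp [fill, hr]; omega) ?_
  · rw [fillProg]
    refine wp_mono (wp_frame (wp_seq.2 (wp_copy.2 ⟨by omega, wp_seq.2 (wp_copy.2
      ⟨?_, ?_⟩)⟩)) (Q := fun t s' => t ≤ E * (n * 10 + 22) + 4 ∧
      Rep d E D S (fill D S N E).1 s'.mem ∧ s'.reg 15 = (fill D S N E).2 ∧
      (fill D S N E).2 ≤ d))
      fun t s' ⟨⟨h₁, h₂, h₃, h₄⟩, h₅⟩ => ⟨h₁, h₂, h₃, h₄, h₅⟩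
    · simp [he.r2]
      omega
    · simp only [State.setReg_reg, Nat.reduceEqDiff, if_false, he.r2, ← hN]
      refine wp_mono key fun t s' ⟨h₁, h₂, _⟩ => ?_
      simp only [State.setReg_reg, Nat.reduceEqDiff, if_false, h8, Nat.add_assoc,
        Nat.reduceAdd] at h₁ h₂
      exact ⟨by omega, h₂.1, h₂.2.1, h₂.2.2.1⟩
  · rintro j s₁ hj hi hfr ⟨hrep, h15, hmc, h14⟩
    simp only [State.setReg_reg, Nat.reduceEqDiff, if_false, h8] at hj
    have hfr' : ∀ x, x ∉ fillBody.writes → x ≠ 20 → s₁.reg x = s.reg x := fun x hx hx' => by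
      have h1 : x ≠ 14 := fun h => hx (by rw [h]; decide)
      have h2 : x ≠ 15 := fun h => hx (by rw [h]; decide)
      rw [hfr x hx hx', State.setReg_reg, if_neg h2, State.setReg_reg, if_neg h1]
    have e := he.frame hfr' (by decide)
    have hslot := hrep.slot j hj
    have hS : S j ≤ d := by
      rw [← hslot]
      exact hrep.le _
    have hx : N / (n + 1) ^ j ≤ N := Nat.div_le_self _ _
    have hx1 : N / (n + 1) ^ j % (n + 1) ≤ N / (n + 1) ^ j := Nat.mod_le _ _
    have hx2 : N / (n + 1) ^ j / (n + 1) = N / (n + 1) ^ (j + 1) := by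
      rw [Nat.div_div_eq_div_mul, pow_succ]
    have hx3 : N / (n + 1) ^ (j + 1) ≤ N := Nat.div_le_self _ _
    simp only [fill, fillStep]
    set p := fill D S N j with hp
    set g := N / (n + 1) ^ j % (n + 1) with hg
    rw [fillBody]
    simp only [wp_seq, wp_arith, wp_cond, wp_load, Op.eval, State.setReg_reg,
      State.setReg_mem, hi, e.r0, e.r3, e.r4, e.r5, e.r6, h14, hslot, ← hg, hx2, Test.holds_lt,
      Test.holds_eq, Nat.reduceEqDiff, if_true, if_false]
    refine ⟨by omega, by omega, by omega, by omega, fun hgn => ?_, fun hgn => ?_⟩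
    · have hcol := hrep.col ⟨g, hgn⟩
      have l1 := hrep.le (n * n + g)
      simp only at hcol
      rw [hcol] at l1
      simp only [hcol, dif_pos hgn]
      refine ⟨by omega, by omega, fun h0 => ?_, fun h0 => ?_⟩
      · refine wp_mono (wp_checkProg (n := n) (d := d) (E := E) (D := D) (S := S) (col := p.1)
          (v := ⟨g, hgn⟩) (c := S j) (e.congr (by simp)) (by simpa using hrep) hd (by simp)
          (by simp) (by omega)) fun t s₂ ⟨ht, hm₂, hbad, hfr₂⟩ => ?_
        have f21 := hfr₂ 21 (by decide)
        have f14 := hfr₂ 14 (by decide)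
        have f23 := hfr₂ 23 (by decide)
        have f15 := hfr₂ 15 (by decide)
        have f6 := hfr₂ 6 (by decide)
        simp only [State.setReg_reg, State.setReg_mem, Nat.reduceEqDiff, if_true, if_false, e.r6,
          h15] at f21 f14 f23 f15 f6 hm₂
        simp only [wp_store, wp_copy, wp_skip, State.setReg_reg,
          State.setReg_mem, State.setMem_mem, State.setMem_reg, f21, f14, f23, f15, f6, hm₂, hbad,
          h0, Nat.reduceEqDiff, if_true, if_false, true_and]
        refine ⟨fun hb => ⟨fun hlt => ⟨by omega, ?_⟩, fun hlt => ?_⟩, fun hb => ?_⟩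
        · rw [if_pos hb]
          exact ⟨by omega, hrep.update ⟨g, hgn⟩ hS, (max_eq_right hlt.le).symm, max_le hmc hS,
            trivial⟩
        · rw [if_pos hb]
          exact ⟨by omega, hrep.update ⟨g, hgn⟩ hS, (max_eq_left (not_lt.1 hlt)).symm,
            max_le hmc hS, trivial⟩
        · rw [if_neg hb]
          exact ⟨by omega, hrep, rfl, hmc, trivial⟩
      · simp only [wp_skip, State.setReg_reg, State.setReg_mem, h0, false_and, if_false,
          Nat.reduceEqDiff, if_true, h15]
        exact ⟨by omega, hrep, trivial, hmc, trivial⟩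
    · simp only [wp_skip, State.setReg_reg, State.setReg_mem, dif_neg hgn,
          Nat.reduceEqDiff, if_true, if_false, h15]
      exact ⟨by omega, hrep, trivial, hmc, trivial⟩

theorem wp_simplicialProg (he : Env n d s) (hr : Rep d E D S col s.mem) (hd : 0 < d)
    {v : Fin n} (hv : s.reg 17 = v) (hW : n * n + n + d < W) :
    wp W simplicialProg (fun t s' => t ≤ n * n * 21 + 3 ∧ s'.mem = s.mem ∧
      (s'.reg 25 = 0 ↔ IsSimplicial D col v) ∧
      ∀ x, x ∉ simplicialProg.writes → s'.reg x = s.reg x) s := by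
  have hn : 0 < n := v.pos
  have key := wp_forLoop (W := W) (i := 26) (m := 3) (T := 19) (s := s.setReg 25 0)
    (body := .seq (.arith .div 27 26 0) <| .seq (.arith .mod 28 26 0) <| .seq (.load 29 26) <|
      when (.lt 2 29) <|
      .seq (.arith .mul 30 17 0) <| .seq (.arith .add 31 30 27) <| .seq (.load 31 31) <|
      when (.eq 31 2) <|
      .seq (.arith .add 31 30 28) <| .seq (.load 31 31) <| when (.eq 31 2) <|
      .seq (.arith .add 31 3 27) <| .seq (.load 31 31) <| when (.eq 31 6) <|
      .seq (.arith .add 31 3 28) <| .seq (.load 31 31) <| when (.eq 31 6) <| .const 25 1)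
    (fun j s' => s'.mem = s.mem ∧ (s'.reg 25 = 0 ↔ ∀ a b : Fin n, a.1 * n + b.1 < j →
      col a = 0 → col b = 0 → D v a = 1 → D v b = 1 → D a b ≤ 1))
    (by decide) (by simp [he.r2]) (by simp [he.r3]; omega) (by simp) ?_
  · rw [simplicialProg]
    refine wp_mono (wp_frame (wp_const_seq (by omega) key))
      fun t s' ⟨⟨t', ht, h₁, h₂, _⟩, h₃⟩ => ⟨?_, ?_, ?_, h₃⟩
    · simp only [State.setReg_reg, Nat.reduceEqDiff, if_false, he.r3] at h₁
      omega
    · exact h₂.1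
    · have h := h₂.2
      simp only [State.setReg_reg, Nat.reduceEqDiff, if_false, he.r3] at h
      rw [h]
      exact ⟨fun h a b => h a b (index_lt a.2 b.2), fun h a b _ => h a b⟩
  · rintro j s₁ hj hi hfr ⟨hm, hI⟩
    simp only [State.setReg_reg, Nat.reduceEqDiff, if_false, he.r3] at hj
    have hfr' : ∀ x, x ∉ [27, 28, 29, 30, 31, 25] → x ≠ 26 → s₁.reg x = s.reg x :=
      fun x hx hx' => by
        rw [hfr x (fun h => hx ?_) hx', State.setReg_reg, if_neg]
        · rintro rfl
          simp at hx
        · simp [Prog.writes] at h ⊢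
          tauto
    have e := he.frame hfr' (by decide)
    have e17 : s₁.reg 17 = v := by rw [hfr' 17 (by decide) (by decide), hv]
    obtain ⟨a, ha⟩ : ∃ a : Fin n, a.1 = j / n := ⟨⟨j / n, Nat.div_lt_of_lt_mul hj⟩, rfl⟩
    obtain ⟨b, hb⟩ : ∃ b : Fin n, b.1 = j % n := ⟨⟨j % n, Nat.mod_lt _ hn⟩, rfl⟩
    have hab : a.1 * n + b.1 = j := by
      rw [ha, hb, mul_comm]
      exact Nat.div_add_mod j n
    have split : (∀ a b : Fin n, a.1 * n + b.1 < j + 1 →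
        col a = 0 → col b = 0 → D v a = 1 → D v b = 1 → D a b ≤ 1) ↔
        (∀ a b : Fin n, a.1 * n + b.1 < j →
          col a = 0 → col b = 0 → D v a = 1 → D v b = 1 → D a b ≤ 1) ∧
        (col a = 0 → col b = 0 → D v a = 1 → D v b = 1 → D a b ≤ 1) := by
      constructor
      · exact fun h => ⟨fun a b hab => h a b (by omega), h a b (by omega)⟩
      · rintro ⟨h1, h2⟩ a' b' hab'
        rcases Nat.lt_succ_iff_lt_or_eq.1 hab' with hlt | heq
        · exact h1 a' b' hlt
        · have ha' : a' = a := by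
            apply Fin.ext
            rw [ha, ← heq, mul_comm, Nat.mul_add_div hn, Nat.div_eq_of_lt b'.2, add_zero]
          have hb' : b' = b := by
            apply Fin.ext
            rw [hb, ← heq, mul_comm, Nat.mul_add_mod, Nat.mod_eq_of_lt b'.2]
          rw [ha', hb']
          exact h2
    have d1 := hr.dist a b
    have d2 := hr.dist v a
    have d3 := hr.dist v b
    have c1 := hr.col a
    have c2 := hr.col b
    have l1 := hr.le (a * n + b)
    have l2 := hr.le (v * n + a)
    have l3 := hr.le (v * n + b)
    have l4 := hr.le (n * n + a)
    have l5 := hr.le (n * n + b)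
    rw [d1] at l1
    rw [d2] at l2
    rw [d3] at l3
    rw [c1] at l4
    rw [c2] at l5
    rw [hab] at d1
    have i1 := index_lt v.2 a.2
    have i2 := index_lt v.2 b.2
    have i3 := a.2
    have i4 := b.2
    simp only [wp_seq, wp_arith, wp_cond, wp_const, wp_load, wp_skip, Op.eval, State.setReg_reg,
      State.setReg_mem, hi, e.r0, e.r2, e.r3, e.r6, e17, ← ha, ← hb, d1, d2, d3, c1, c2, hm,
      Test.holds_lt, Test.holds_eq, Nat.reduceEqDiff, if_true, if_false, split, hI]
    refine ⟨by omega, by omega, by omega, fun h1 => ⟨by omega, by omega, by omega,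
      fun h2 => ⟨by omega, by omega, fun h3 => ⟨by omega, by omega, fun h4 => ⟨by omega, by omega,
      fun h5 => ⟨by omega, ?_⟩, fun h5 => ?_⟩, fun h4 => ?_⟩, fun h3 => ?_⟩, fun h2 => ?_⟩,
      fun h1 => ?_⟩
    · refine ⟨by omega, trivial, ?_⟩
      simp only [false_iff, not_and]
      exact fun _ h => absurd (h h4 h5 h2 h3) (not_le.2 h1)
    all_goals
      exact ⟨by omega, trivial, fun h => ⟨h, fun _ _ _ _ => by omega⟩, fun h => h.1⟩

theorem wp_killProg (he : Env n d s) (hr : Rep d E D S col s.mem) (hd : 0 < d)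
    {v : Fin n} (hv : s.reg 17 = v) (hW : n * n + n + d < W) :
    wp W killProg (fun t s' => t ≤ n * 11 + 2 ∧
      Rep d E D S (fun a => if col a = 0 ∧ D v a = 1 then d else col a) s'.mem ∧
      ∀ x, x ∉ killProg.writes → s'.reg x = s.reg x) s := by
  have key := wp_forLoop (W := W) (i := 26) (m := 0) (T := 9) (s := s)
    (body := .seq (.arith .add 27 3 26) <| .seq (.load 28 27) <| when (.eq 28 6) <|
      .seq (.arith .mul 29 17 0) <| .seq (.arith .add 29 29 26) <| .seq (.load 29 29) <|
      when (.eq 29 2) (.store 27 1))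
    (fun j s' => Rep d E D S
      (fun a => if a.1 < j ∧ col a = 0 ∧ D v a = 1 then d else col a) s'.mem)
    (by decide) he.r2 (by rw [he.r0]; omega) (by simpa using hr) ?_
  · rw [killProg]
    refine wp_mono (wp_frame key) fun t s' ⟨⟨h₁, h₂, _⟩, h₃⟩ => ⟨?_, ?_, h₃⟩
    · rwa [he.r0] at h₁
    · simpa [he.r0] using h₂
  · intro j s₁ hj hi hfr hI
    rw [he.r0] at hj
    have e := he.frame hfr (by decide)
    have e17 : s₁.reg 17 = v := by rw [hfr 17 (by decide) (by decide), hv]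
    have hcol := hI.col ⟨j, hj⟩
    have hdist := hI.dist v ⟨j, hj⟩
    simp only [lt_self_iff_false, false_and, if_false] at hcol hdist
    have l1 := hI.le (n * n + j)
    have l2 := hI.le (v * n + j)
    rw [hcol] at l1
    rw [hdist] at l2
    have i1 := index_lt v.2 hj
    have keep : ¬ (col ⟨j, hj⟩ = 0 ∧ D v ⟨j, hj⟩ = 1) → Rep d E D S
        (fun a => if a.1 < j + 1 ∧ col a = 0 ∧ D v a = 1 then d else col a) s₁.mem := by
      intro h
      convert hI using 1
      funext a
      by_cases ha : a = ⟨j, hj⟩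
      · subst ha
        simp only [h, and_false, if_false]
      · have : a.1 ≠ j := fun h => ha (Fin.ext h)
        have : a.1 < j + 1 ↔ a.1 < j := by omega
        simp only [this]
    simp only [wp_seq, wp_arith, wp_cond, wp_store, wp_load, wp_skip, Op.eval, State.setReg_reg,
      State.setReg_mem, State.setMem_mem, hi, e.r0, e.r1, e.r2, e.r3, e.r6, e17, hcol, hdist,
      Test.holds_eq, Nat.reduceEqDiff, if_true, if_false]
    refine ⟨by omega, by omega, fun h1 => ⟨by omega, by omega, by omega, fun h2 => ?_,
      fun h2 => ?_⟩, fun h1 => ?_⟩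
    · refine ⟨by omega, ?_⟩
      convert hI.update ⟨j, hj⟩ le_rfl using 1
      funext a
      by_cases ha : a = ⟨j, hj⟩
      · subst ha
        simp [h1, h2]
      · have : a.1 ≠ j := fun h => ha (Fin.ext h)
        have : a.1 < j + 1 ↔ a.1 < j := by omega
        simp only [Function.update_of_ne ha, this]
    · exact ⟨by omega, keep fun h => h2 h.2⟩
    · exact ⟨by omega, keep fun h => h1 h.1⟩

theorem wp_misProg [NeZero n] (he : Env n d s) (hr : Rep d E D S col s.mem) (hd : 0 < d)
    (hW : n * n + n + d < W) :
    wp W misProg (fun t s' => t ≤ n * n * (n * n * 21 + n * 11 + 15) + 2 ∧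
      Rep d E D S (mis D d col (n * n)) s'.mem ∧
      ∀ x, x ∉ misProg.writes → s'.reg x = s.reg x) s := by
  have hn : 0 < n := Nat.pos_of_neZero n
  have key := wp_forLoop (W := W) (i := 16) (m := 3) (T := n * n * 21 + n * 11 + 13) (s := s)
    (body := misBody) (fun j s' => Rep d E D S (mis D d col j) s'.mem)
    (by decide) he.r2 (by rw [he.r3]; omega) (by simpa [mis] using hr) ?_
  · rw [misProg]
    refine wp_mono (wp_frame key) fun t s' ⟨⟨h₁, h₂, _⟩, h₃⟩ => ⟨?_, ?_, h₃⟩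
    · rwa [he.r3] at h₁
    · rwa [he.r3] at h₂
  · intro j s₁ hj hi hfr hI
    rw [he.r3] at hj
    have e := he.frame hfr (by decide)
    obtain ⟨v, hv⟩ : ∃ v : Fin n, v = Fin.ofNat n j := ⟨_, rfl⟩
    have hv' : j % n = v.1 := by rw [hv]; rfl
    simp only [mis, misStep, ← hv]
    set col' := mis D d col j
    have hcol := hI.col v
    have l1 := hI.le (n * n + v)
    rw [hcol] at l1
    have i1 := v.2
    rw [misBody]
    simp only [wp_seq, wp_arith, wp_cond, wp_load, wp_skip, Op.eval, State.setReg_reg,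
      State.setReg_mem, hi, e.r0, e.r3, e.r6, hcol, hv', Test.holds_eq, Nat.reduceEqDiff, if_true,
      if_false]
    refine ⟨by omega, by omega, by omega, fun h0 => ?_, fun h0 => ?_⟩
    · refine wp_mono (wp_simplicialProg (n := n) (d := d) (E := E) (D := D) (S := S)
        (col := col') (v := v) (e.congr (by simp)) (by simpa using hI) hd (by simp)
        (by omega)) fun t s₂ ⟨ht, hm₂, hbad, hfr₂⟩ => ?_
      have f6 := hfr₂ 6 (by decide)
      have f2 := hfr₂ 2 (by decide)
      have f17 := hfr₂ 17 (by decide)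
      have f18 := hfr₂ 18 (by decide)
      simp only [State.setReg_reg, State.setReg_mem, Nat.reduceEqDiff, if_true, if_false, e.r6,
        e.r2] at f6 f2 f17 f18 hm₂
      simp only [f6, hbad, h0, true_and]
      refine ⟨fun hb => ?_, fun hb => ?_⟩
      · have e₂ : Env n d s₂ := e.congr fun x hx => by
          rw [hfr₂ x (by revert x; decide)]
          simp only [State.setReg_reg]
          have : x ≠ 17 ∧ x ≠ 18 ∧ x ≠ 19 := by revert x; decide
          simp [this]
        refine wp_mono (wp_killProg (n := n) (d := d) (E := E) (D := D) (S := S) (col := col')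
          (v := v) e₂ (by rwa [hm₂]) hd f17 (by omega)) fun t' s₃ ⟨ht', hr', hfr₃⟩ => ?_
        have g2 := hfr₃ 2 (by decide)
        have g18 := hfr₃ 18 (by decide)
        simp only [wp_store, g2, g18, f2, f18, State.setMem_mem]
        refine ⟨by omega, ?_⟩
        rw [if_pos hb]
        convert hr'.update v (c := 1) hd using 1
        funext a
        rw [Function.update_apply]
      · rw [if_neg hb]
        simp only [hm₂]
        exact ⟨by omega, hI⟩
    · rw [if_neg (fun h => h0 h.1)]
      exact ⟨by omega, hI⟩

theorem wp_countProg (he : Env n d s) (hr : Rep d E D S col s.mem)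
    (hW : n * n + n + d + 1 < W) :
    wp W countProg (fun t s' => t ≤ n * 6 + 3 ∧ s'.mem = s.mem ∧
      s'.reg 21 = (Finset.univ.filter fun v => col v = d).card ∧
      ∀ x, x ∉ countProg.writes → s'.reg x = s.reg x) s := by
  have key := wp_forLoop (W := W) (i := 20) (m := 0) (T := 4) (s := s.setReg 21 0)
    (body := .seq (.arith .add 22 3 20) <| .seq (.load 22 22) <| when (.eq 22 1) <|
      .arith .add 21 21 2)
    (fun j s' => s'.mem = s.mem ∧
      s'.reg 21 = (Finset.univ.filter fun v : Fin n => v.1 < j ∧ col v = d).card)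
    (by decide) (by simp [he.r2]) (by simp [he.r0]; omega) (by simp) ?_
  · rw [countProg]
    refine wp_mono (wp_frame (wp_const_seq (by omega) key))
      fun t s' ⟨⟨t', ht, h₁, h₂, _⟩, h₃⟩ => ⟨?_, ?_, ?_, h₃⟩
    · simp only [State.setReg_reg, Nat.reduceEqDiff, if_false, he.r0] at h₁
      omega
    · exact h₂.1
    · simpa [he.r0] using h₂.2
  · rintro j s₁ hj hi hfr ⟨hm, hI⟩
    simp only [State.setReg_reg, Nat.reduceEqDiff, if_false, he.r0] at hj
    have hfr' : ∀ x, x ∉ [21, 22] → x ≠ 20 → s₁.reg x = s.reg x := fun x hx hx' => by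
      rw [hfr x (fun h => hx ?_) hx', State.setReg_reg, if_neg]
      · rintro rfl
        simp at hx
      · simp [Prog.writes] at h ⊢
        tauto
    have e := he.frame hfr' (by decide)
    have hcol := hr.col ⟨j, hj⟩
    have l1 := hr.le (n * n + j)
    rw [hcol] at l1
    simp only at hcol
    have hlt : (Finset.univ.filter fun v : Fin n => v.1 < j ∧ col v = d).card ≤ n :=
      (Finset.card_le_univ _).trans_eq (Fintype.card_fin n)
    simp only [wp_seq, wp_arith, wp_cond, wp_load, wp_skip, Op.eval, State.setReg_reg,
      State.setReg_mem, hi, e.r1, e.r2, e.r3, hm, hcol, hI, Test.holds_eq, Nat.reduceEqDiff,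
      if_true, if_false]
    refine ⟨by omega, by omega, fun h => ⟨by omega, by omega, trivial, ?_⟩, fun h =>
      ⟨by omega, trivial, ?_⟩⟩
    · have : (Finset.univ.filter fun v : Fin n => v.1 < j + 1 ∧ col v = d) =
          insert ⟨j, hj⟩ (Finset.univ.filter fun v : Fin n => v.1 < j ∧ col v = d) := by
        ext v
        simp only [Finset.mem_filter, Finset.mem_univ, true_and, Finset.mem_insert, Fin.ext_iff]
        constructor
        · rintro ⟨h1, h2⟩
          rcases Nat.lt_succ_iff_lt_or_eq.1 h1 with h1 | h1
          · exact Or.inr ⟨h1, h2⟩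
          · exact Or.inl h1
        · rintro (h1 | ⟨h1, h2⟩)
          · have : v = ⟨j, hj⟩ := Fin.ext h1
            exact ⟨by omega, by rw [this, h]⟩
          · exact ⟨by omega, h2⟩
      rw [this, Finset.card_insert_of_notMem (by simp)]
    · congr 1
      ext v
      simp only [Finset.mem_filter, Finset.mem_univ, true_and]
      constructor
      · exact fun h => ⟨by omega, h.2⟩
      · rintro ⟨h1, h2⟩
        rcases Nat.lt_succ_iff_lt_or_eq.1 h1 with h1 | h1
        · exact ⟨h1, h2⟩
        · have : v = ⟨j, hj⟩ := Fin.ext h1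
          exact absurd (by rwa [this] at h2) h

theorem wp_mainBody [NeZero n] (he : Env n d s) (hr : Rep d E D S col s.mem) (hd : 0 < d)
    (h8 : s.reg 8 = E) (hW : n * n + n + d + E + s.reg 13 + 1 < W) :
    wp W mainBody (fun t s' =>
      t ≤ n * n * (n * n * 21 + n * 11 + 15) + E * (n * 10 + 22) + n * 10 + 15 ∧
      (∃ col', Rep d E D S col' s'.mem) ∧
      s'.reg 10 = min (s.reg 10) (result D d E S (s.reg 13)) ∧
      ∀ x, x ∉ mainBody.writes → s'.reg x = s.reg x) s := by
  have hn : 0 < n := Nat.pos_of_neZero n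
  have key : wp W mainBody (fun t s' =>
      t ≤ n * n * (n * n * 21 + n * 11 + 15) + E * (n * 10 + 22) + n * 10 + 15 ∧
      (∃ col', Rep d E D S col' s'.mem) ∧
      s'.reg 10 = min (s.reg 10) (result D d E S (s.reg 13))) s := by
    rw [mainBody]
    refine wp_seq.2 (wp_mono (wp_clearProg he hr (by omega)) fun t₁ s₁ ⟨ht₁, hr₁, hfr₁⟩ => ?_)
    have e₁ : Env n d s₁ := he.congr fun x hx => hfr₁ x (by revert x; decide)
    have f8 := hfr₁ 8 (by decide)
    have f13 := hfr₁ 13 (by decide)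
    refine wp_seq.2 (wp_mono (wp_fillProg e₁ hr₁ hd hn (by rw [f8, h8]) (by rw [f13]; omega))
      fun t₂ s₂ ⟨ht₂, hr₂, h15, hmc, hfr₂⟩ => ?_)
    rw [f13] at hr₂ h15 hmc
    have e₂ : Env n d s₂ := e₁.congr fun x hx => hfr₂ x (by revert x; decide)
    refine wp_seq.2 (wp_mono (wp_misProg e₂ hr₂ hd (by omega))
      fun t₃ s₃ ⟨ht₃, hr₃, hfr₃⟩ => ?_)
    have e₃ : Env n d s₃ := e₂.congr fun x hx => hfr₃ x (by revert x; decide)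
    refine wp_seq.2 (wp_mono (wp_countProg e₃ hr₃ (by omega))
      fun t₄ s₄ ⟨ht₄, hm₄, h21, hfr₄⟩ => ?_)
    have e₄ : Env n d s₄ := e₃.congr fun x hx => hfr₄ x (by revert x; decide)
    have g15 : s₄.reg 15 = (fill D S (s.reg 13) E).2 := by
      rw [hfr₄ 15 (by decide), hfr₃ 15 (by decide), h15]
    have g10 : s₄.reg 10 = s.reg 10 := by
      rw [hfr₄ 10 (by decide), hfr₃ 10 (by decide), hfr₂ 10 (by decide), hfr₁ 10 (by decide)]
    have hU : (Finset.univ.filter fun v =>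
        mis D d (fill D S (s.reg 13) E).1 (n * n) v = d).card ≤ n :=
      (Finset.card_le_univ _).trans_eq (Fintype.card_fin n)
    have hrep : ∃ col', Rep d E D S col' s₄.mem := ⟨_, by rw [hm₄]; exact hr₃⟩
    rw [updateProg, result]
    simp only [wp_seq, wp_cond, wp_copy, wp_arith, wp_skip, Op.eval, State.setReg_reg,
      State.setReg_mem, e₄.r6, e₄.r7, h21, g15, g10, Test.holds_lt, Test.holds_eq,
      Nat.reduceEqDiff, if_true, if_false]
    refine ⟨fun h => ⟨by omega, fun h' => ⟨by omega, ?_⟩, fun h' => ?_⟩,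
      fun h => ⟨by omega, fun h' => ⟨by omega, ?_⟩, fun h' => ?_⟩⟩
    · rw [if_pos h]
      exact ⟨by omega, hrep, by omega⟩
    · rw [if_pos h]
      exact ⟨by omega, hrep, by omega⟩
    · rw [if_neg h]
      exact ⟨by omega, hrep, by omega⟩
    · rw [if_neg h]
      exact ⟨by omega, hrep, by omega⟩
  exact wp_mono (wp_frame key) fun t s' ⟨⟨h₁, h₂, h₃⟩, h₄⟩ => ⟨h₁, h₂, h₃, h₄⟩

/-- A bound on the number of steps of the program. -/
def timeBound (n d E : ℕ) : ℕ :=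
  (n + 1) ^ E * (n * n * (n * n * 21 + n * 11 + 15) + E * (n * 10 + 22) + n * 10 + 17) +
    n * n * 9 + n * n * n * d * 18 + d * d * 13 + 30

theorem wp_packingProg [NeZero n] (hd : 2 ≤ d) (h0 : s.reg 0 = n) (h1 : s.reg 1 = d)
    (hm : ∀ a, s.mem a ≤ 1)
    (hD : ∀ u v : Fin n, relax n (fun a => if a < n * n then initMatrix n d s.mem a else s.mem a)
      (n * n * n * d) (u * n + v) = D u v)
    (hE : E = (slotColors d (d * d)).length)
    (hW : n * n * n * d + n * n + n + d + d + d * d + E + (n + 1) ^ E + 2 < W) :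
    wp W packingProg (fun t s' => t ≤ timeBound n d E ∧
      s'.reg 0 = best D d E ((slotColors d (d * d)).getD · 0) ((n + 1) ^ E)) s := by
  have hn : 0 < n := Nat.pos_of_neZero n
  have hnn : n * n ≤ n * n * n := Nat.le_mul_of_pos_right _ hn
  have hnd : n * n * n ≤ n * n * n * d := Nat.le_mul_of_pos_right _ (by omega)
  rw [packingProg]
  simp only [wp_seq, wp_const, wp_cond, Test.holds_eq, State.setReg_reg, h1, Nat.reduceEqDiff,
    if_true, if_false]
  refine ⟨by omega, fun h => by omega, fun _ => ?_⟩
  have setup : wp W setupProg (fun t s' => t = 11 ∧ Env n d s' ∧ s'.reg 8 = 0 ∧ s'.reg 9 = 1 ∧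
      s'.reg 10 = n ∧ s'.mem = s.mem) (s.setReg 2 1) := by
    rw [setupProg]
    simp only [wp_seq, wp_const, wp_arith, wp_copy, Op.eval, State.setReg_reg, State.setReg_mem,
      h0, h1, Nat.reduceEqDiff, if_true, if_false, OfNat.zero_ne_ofNat,
      OfNat.one_ne_ofNat]
    refine ⟨by omega, by omega, by omega, by omega, by omega, by omega, by omega, by omega,
      by omega, by omega, by omega, trivial, ?_, trivial, trivial, trivial, trivial⟩
    constructor <;> simp [h0, h1]
  refine wp_mono setup fun t₁ s₁ ⟨ht₁, e₁, h8, h9, h10, hm₁⟩ => ?_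
  refine wp_mono (wp_initMatrixProg e₁ hn (by omega)
    (fun a => by rw [hm₁]; exact (hm a).trans (by omega)) (by omega))
    fun t₂ s₂ ⟨ht₂, hm₂, hfr₂⟩ => ?_
  have e₂ : Env n d s₂ := e₁.congr fun x hx => hfr₂ x (by revert x; decide)
  rw [hm₁] at hm₂
  have hle₂ : ∀ a, s₂.mem a ≤ d := fun a => by
    rw [hm₂]
    have := hm a
    simp only [initMatrix]
    split_ifs <;> omega
  refine wp_mono (wp_relaxProg e₂ hn hle₂ (by omega)) fun t₃ s₃ ⟨ht₃, hm₃, hfr₃⟩ => ?_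
  have e₃ : Env n d s₃ := e₂.congr fun x hx => hfr₃ x (by revert x; decide)
  have hle₃ : ∀ a, s₃.mem a ≤ d := by
    rw [hm₃]
    exact relax_le hle₂ _
  rw [hm₂] at hm₃
  refine wp_mono (wp_slotsProg e₃ (by omega) hle₃
    (by rw [hfr₃ 8 (by decide), hfr₂ 8 (by decide), h8])
    (by rw [hfr₃ 9 (by decide), hfr₂ 9 (by decide), h9]) (by rw [← hE]; omega))
    fun t₄ s₄ ⟨ht₄, k8, k9, hlow, hslot, hle₄, hfr₄⟩ => ?_
  have e₄ : Env n d s₄ := e₃.congr fun x hx => hfr₄ x (by revert x; decide)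
  rw [← hE] at k8 k9 hslot
  have hrep : Rep d E D ((slotColors d (d * d)).getD · 0) (fun v => s₄.mem (n * n + v))
      s₄.mem :=
    ⟨fun u v => by
      have := index_lt u.2 v.2
      rw [hlow _ (by omega), hm₃, hD], fun _ => rfl, hslot, hle₄⟩
  have hb : s₄.reg 10 = n := by
    rw [hfr₄ 10 (by decide), hfr₃ 10 (by decide), hfr₂ 10 (by decide), h10]
  have key := wp_forLoop (W := W) (i := 13) (m := 9)
    (T := n * n * (n * n * 21 + n * 11 + 15) + E * (n * 10 + 22) + n * 10 + 15) (s := s₄)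
    (body := mainBody)
    (fun j s' => (∃ col', Rep d E D ((slotColors d (d * d)).getD · 0) col' s'.mem) ∧
      s'.reg 10 = best D d E ((slotColors d (d * d)).getD · 0) j)
    (by decide) e₄.r2 (by rw [k9]; omega) ⟨⟨_, hrep⟩, by simpa [best] using hb⟩ ?_
  · refine wp_mono key fun t₅ s₅ ⟨ht₅, ⟨_, h₅⟩, _⟩ => ?_
    have hbest : ∀ N, best D d E ((slotColors d (d * d)).getD · 0) N ≤ n := by
      intro N
      induction N with
      | zero => exact le_rfl
      | succ N ih => exact (min_le_left _ _).trans ih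
    rw [k9] at h₅ ht₅
    have := hbest ((n + 1) ^ E)
    simp only [wp_copy, State.setReg_reg, if_true, h₅, timeBound]
    rw [add_assoc _ 15 2, show 15 + 2 = 17 from rfl] at ht₅
    exact ⟨by omega, by omega, trivial⟩
  · rintro j s₅ hj hi hfr₅ ⟨⟨col', hr₅⟩, h₅⟩
    rw [k9] at hj
    have e₅ := e₄.frame hfr₅ (by decide)
    refine wp_mono (wp_mainBody e₅ hr₅ (by omega)
      (by rw [hfr₅ 8 (by decide) (by decide), k8]) (by rw [hi]; omega))
      fun t₆ s₆ ⟨ht₆, hr₆, h₆, _⟩ => ?_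
    rw [h₅, hi] at h₆
    exact ⟨ht₆, hr₆, by simpa [best] using h₆⟩

end RAM

/-! ### Relaxation computes the distances -/

namespace PackingColoring

variable {n : ℕ}

theorem index_inj {u v u' v' : Fin n} (h : (u : ℕ) * n + v = u' * n + v') : u = u' ∧ v = v' := by
  have hn : 0 < n := u.pos
  have h1 := congrArg (· / n) h
  have h2 := congrArg (· % n) h
  simp only [mul_comm _ n, Nat.mul_add_div hn, Nat.mul_add_mod, Nat.div_eq_of_lt v.2,
    Nat.div_eq_of_lt v'.2, Nat.mod_eq_of_lt v.2, Nat.mod_eq_of_lt v'.2, add_zero] at h1 h2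
  exact ⟨Fin.ext h1, Fin.ext h2⟩

theorem relax_antitone (n : ℕ) (m : ℕ → ℕ) (a : ℕ) : Antitone fun q => relax n m q a := by
  refine antitone_nat_of_succ_le fun q => ?_
  change relaxStep n q (relax n m q) a ≤ _
  unfold relaxStep
  split_ifs with h
  · rw [Function.update_apply]
    split_ifs with ha
    · rw [ha]
      exact h.le
    · rfl
  · rfl

theorem relax_succ_le (m : ℕ → ℕ) (q : ℕ) {u v w : Fin n} (hu : q / n / n % n = u)
    (hv : q / n % n = v) (hw : q % n = w) :
    relax n m (q + 1) (u * n + v) ≤ relax n m q (u * n + w) + relax n m q (w * n + v) := by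
  change relaxStep n q (relax n m q) _ ≤ _
  rw [relaxStep, hu, hv, hw]
  split_ifs with h
  · rw [Function.update_self]
  · exact not_lt.1 h

/-- The entries never drop below the distances, as these satisfy the triangle inequality. -/
theorem dist_le_relax {G : SimpleGraph (Fin n)} (hG : G.Connected) {m : ℕ → ℕ}
    (hm : ∀ u v : Fin n, G.dist u v ≤ m (u * n + v)) (q : ℕ) (u v : Fin n) :
    G.dist u v ≤ relax n m q (u * n + v) := by
  have hn : 0 < n := u.pos
  induction q generalizing u v with
  | zero => exact hm u v
  | succ q ih =>
    change _ ≤ relaxStep n q (relax n m q) _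
    obtain ⟨u', hu'⟩ : ∃ u' : Fin n, q / n / n % n = u' := ⟨⟨_, Nat.mod_lt _ hn⟩, rfl⟩
    obtain ⟨v', hv'⟩ : ∃ v' : Fin n, q / n % n = v' := ⟨⟨_, Nat.mod_lt _ hn⟩, rfl⟩
    obtain ⟨w', hw'⟩ : ∃ w' : Fin n, q % n = w' := ⟨⟨_, Nat.mod_lt _ hn⟩, rfl⟩
    rw [relaxStep, hu', hv', hw']
    split_ifs with h
    · rw [Function.update_apply]
      split_ifs with ha
      · obtain ⟨rfl, rfl⟩ := index_inj ha
        exact (hG.dist_triangle (v := w')).trans (add_le_add (ih _ _) (ih _ _))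
      · exact ih u v
    · exact ih u v

/-- After `r` rounds, each of which goes through all triples, the distances up to `r + 1` are
correct. -/
theorem relax_le_dist {G : SimpleGraph (Fin n)} (hG : G.Connected) {m : ℕ → ℕ}
    (hm : ∀ u v : Fin n, G.dist u v ≤ 1 → m (u * n + v) ≤ G.dist u v) (r q : ℕ) (u v : Fin n)
    (hq : r * (n * n * n) ≤ q) (hr : G.dist u v ≤ r + 1) :
    relax n m q (u * n + v) ≤ G.dist u v := by
  have hn : 0 < n := u.pos
  induction r generalizing u v q with
  | zero => exact (relax_antitone n m _ (Nat.zero_le q)).trans (hm u v hr)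
  | succ r ih =>
    rw [Nat.succ_mul] at hq
    rcases Nat.lt_or_ge (r + 1) (G.dist u v) with hlt | hle
    · obtain ⟨p, hp⟩ := hG.exists_walk_length_eq_dist u v
      cases p with
      | nil => simp at hlt
      | cons h p =>
        rename_i w
        rw [SimpleGraph.Walk.length_cons] at hp
        have huw : G.dist u w = 1 := SimpleGraph.dist_eq_one_iff_adj.2 h
        have hwv : G.dist w v ≤ p.length := SimpleGraph.dist_le p
        have hi : (u : ℕ) * n + v < n * n := RAM.index_lt u.2 v.2
        set q₀ := r * (n * n * n) + (u * n + v) * n + w with hq₀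
        have hlt₀ : q₀ + 1 ≤ q := by
          have h1 : ((u : ℕ) * n + v) * n + w < n * n * n := by
            calc ((u : ℕ) * n + v) * n + w < (u * n + v + 1) * n := by
                  rw [Nat.succ_mul]
                  have := w.2
                  omega
              _ ≤ n * n * n := Nat.mul_le_mul_right _ hi
          omega
        have e1 : q₀ = n * (n * (n * r + u) + v) + w := by
          rw [hq₀]
          ring
        have d1 : q₀ / n = n * (n * r + u) + v := by
          rw [e1, Nat.mul_add_div hn, Nat.div_eq_of_lt w.2, add_zero]
        have d2 : q₀ / n / n = n * r + u := by
          rw [d1, Nat.mul_add_div hn, Nat.div_eq_of_lt v.2, add_zero]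
        have key := relax_succ_le m q₀ (u := u) (v := v) (w := w)
          (by rw [d2, Nat.mul_add_mod, Nat.mod_eq_of_lt u.2])
          (by rw [d1, Nat.mul_add_mod, Nat.mod_eq_of_lt v.2])
          (by rw [e1, Nat.mul_add_mod, Nat.mod_eq_of_lt w.2])
        have h1 := ih q₀ u w (by omega) (by omega)
        have h2 := ih q₀ w v (by omega) (by omega)
        have h3 := relax_antitone n m (u * n + v) hlt₀
        simp only at h3
        omega
    · exact ih q u v (by omega) hle

theorem relax_initMatrix {G : SimpleGraph (Fin n)} (hG : G.Connected) {d : ℕ}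
    (hdiam : ∀ u v, G.dist u v ≤ d) {m : ℕ → ℕ} (hm : ∀ u v : Fin n, m (u * n + v) = 1 ↔ G.Adj u v)
    (u v : Fin n) :
    relax n (fun a => if a < n * n then initMatrix n d m a else m a) (n * n * n * d) (u * n + v) =
      G.dist u v := by
  have hn : 0 < n := u.pos
  have hinit : ∀ u v : Fin n, (if (u : ℕ) * n + v < n * n then initMatrix n d m (u * n + v)
      else m (u * n + v)) =
      if u = v then 0 else if m (u * n + v) = 1 then 1 else d := by
    intro u v
    rw [if_pos (RAM.index_lt u.2 v.2), initMatrix, mul_comm, Nat.mul_add_div hn, Nat.mul_add_mod,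
      Nat.div_eq_of_lt v.2, Nat.mod_eq_of_lt v.2, add_zero, mul_comm]
    simp only [Fin.ext_iff]
  refine le_antisymm (relax_le_dist hG (fun u v h => ?_) d _ u v (by rw [mul_comm]) ?_)
    (dist_le_relax hG (fun u v => ?_) _ u v)
  · rw [hinit]
    split_ifs with h1 h2
    · exact Nat.zero_le _
    · exact (SimpleGraph.dist_eq_one_iff_adj.2 ((hm u v).1 h2)).ge
    · have h3 : G.dist u v ≠ 1 := fun h =>
        h2 ((hm u v).2 (SimpleGraph.dist_eq_one_iff_adj.1 h))
      have h4 : G.dist u v ≠ 0 := fun h => h1 (hG.dist_eq_zero_iff.1 h)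
      omega
  · exact (hdiam u v).trans (by omega)
  · rw [hinit]
    split_ifs with h1 h2
    · simp [h1]
    · exact (SimpleGraph.dist_eq_one_iff_adj.2 ((hm u v).1 h2)).le
    · exact hdiam u v

end PackingColoring

/-! ### Interval graphs -/

namespace PackingColoring

variable {V : Type*} {G : SimpleGraph V}

/-- A walk from a vertex that is not to the right of `y` to one that is not to the left of `y`
passes through the closed neighborhood of `y`. -/
theorem exists_crossing (hG : G.Connected) {l r : V → ℝ}
    (hadj : ∀ u v, u ≠ v → (G.Adj u v ↔ (Set.Icc (l u) (r u) ∩ Set.Icc (l v) (r v)).Nonempty))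
    (y : V) (hy : l y ≤ r y) {x z : V} (p : G.Walk x z) (hx : l x ≤ r y) (hz : l y ≤ r z) :
    ∃ q, (l q ≤ r y ∧ l y ≤ r q) ∧ G.dist x q + G.dist q z ≤ p.length := by
  induction p with
  | nil => exact ⟨_, ⟨hx, hz⟩, by simp⟩
  | cons h p ih =>
    rename_i u v w
    by_cases hu : l y ≤ r u
    · exact ⟨u, ⟨hx, hu⟩, by simpa using SimpleGraph.dist_le (p.cons h)⟩
    · obtain ⟨a, ⟨-, ha₁⟩, ha₂, -⟩ := (hadj u v h.ne).1 h
      obtain ⟨q, hq, hlen⟩ := ih (by linarith) hz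
      refine ⟨q, hq, ?_⟩
      have := hG.dist_triangle (u := u) (v := v) (w := q)
      rw [SimpleGraph.dist_eq_one_iff_adj.2 h] at this
      rw [SimpleGraph.Walk.length_cons]
      omega

theorem dist_le_one_of_overlap {l r : V → ℝ} (hlr : ∀ v, l v ≤ r v)
    (hadj : ∀ u v, u ≠ v → (G.Adj u v ↔ (Set.Icc (l u) (r u) ∩ Set.Icc (l v) (r v)).Nonempty))
    {u v : V} (h₁ : l u ≤ r v) (h₂ : l v ≤ r u) : G.dist u v ≤ 1 := by
  by_cases huv : u = v
  · simp [huv]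
  · refine (SimpleGraph.dist_eq_one_iff_adj.2 ((hadj u v huv).2
      ⟨max (l u) (l v), ⟨le_max_left _ _, max_le (hlr u) h₂⟩,
        le_max_right _ _, max_le h₁ (hlr v)⟩)).le

/-- If the vertices of `s` have pairwise distance more than `c`, then the leftmost and the rightmost
of them have distance at least `(|s| - 1) (c - 1) + 2`: a shortest path between them comes close to
all the others. -/
theorem exists_far (hG : G.Connected) {l r : V → ℝ} (hlr : ∀ v, l v ≤ r v)
    (hadj : ∀ u v, u ≠ v → (G.Adj u v ↔ (Set.Icc (l u) (r u) ∩ Set.Icc (l v) (r v)).Nonempty))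
    {c : ℕ} (hc : 1 ≤ c) (s : Finset V) (hs : ∀ u ∈ s, ∀ v ∈ s, u ≠ v → c < G.dist u v) :
    s.Nonempty → ∃ x ∈ s, ∃ y ∈ s, (∀ z ∈ s, l z ≤ l y) ∧ l x ≤ l y ∧
      (s = {y} ∨ (s.card - 1) * (c - 1) + 2 ≤ G.dist x y) := by
  classical
  induction s using Finset.induction_on_max_value l with
  | empty => simp
  | insert a s has hmax ih =>
    intro _
    rcases s.eq_empty_or_nonempty with rfl | hne
    · exact ⟨a, by simp, a, by simp, by simp, le_rfl, Or.inl (by simp)⟩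
    · obtain ⟨x, hx, y, hy, hy₁, hxy, hcase⟩ := ih (fun u hu v hv => hs u
        (Finset.mem_insert_of_mem hu) v (Finset.mem_insert_of_mem hv)) hne
      have hya : y ≠ a := fun h => has (h ▸ hy)
      have hdya := hs y (Finset.mem_insert_of_mem hy) a (Finset.mem_insert_self a s) hya
      refine ⟨x, Finset.mem_insert_of_mem hx, a, Finset.mem_insert_self a s, ?_,
        hmax x hx, Or.inr ?_⟩
      · intro z hz
        rcases Finset.mem_insert.1 hz with rfl | hz
        exacts [le_rfl, hmax z hz]
      · rw [Finset.card_insert_of_notMem has]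
        rcases hcase with rfl | hdist
        · rw [Finset.mem_singleton] at hx
          subst hx
          rw [Finset.card_singleton]
          omega
        · obtain ⟨p, hp⟩ := hG.exists_walk_length_eq_dist x a
          obtain ⟨q, ⟨hq₁, hq₂⟩, hlen⟩ := exists_crossing hG hadj y (hlr y) p
            (hxy.trans (hlr y)) ((hmax y hy).trans (hlr a))
          have hqy := dist_le_one_of_overlap hlr hadj hq₁ hq₂
          have h1 := hG.dist_triangle (u := x) (v := q) (w := y)
          have h2 := hG.dist_triangle (u := y) (v := q) (w := a)
          rw [SimpleGraph.dist_comm (u := y) (v := q)] at h2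
          obtain ⟨k, hk⟩ : ∃ k, s.card = k + 1 := ⟨s.card - 1, by have := hne.card_pos; omega⟩
          rw [hk] at hdist ⊢
          simp only [Nat.add_sub_cancel] at hdist ⊢
          rw [Nat.succ_mul]
          omega

/-- The classes of a packing coloring, except that of the color `1`, are small. -/
theorem card_packing_le (hG : G.Connected) (hI : G.IsIntervalGraph) {d : ℕ}
    (hdiam : ∀ u v, G.dist u v ≤ d) {c : ℕ} (hc : 1 ≤ c) {s : Finset V}
    (hs : ∀ u ∈ s, ∀ v ∈ s, u ≠ v → c < G.dist u v) : (c - 1) * (s.card - 1) ≤ d - 2 := by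
  obtain ⟨l, r, hlr, hadj⟩ := hI
  rcases s.eq_empty_or_nonempty with rfl | hne
  · simp
  · obtain ⟨x, -, y, -, -, -, rfl | h⟩ := exists_far hG hlr hadj hc s hs hne
    · simp
    · have := hdiam x y
      rw [mul_comm]
      omega

/-- Every nonempty set of vertices contains one whose neighbors in the set form a clique, namely the
one with the smallest right endpoint. -/
theorem exists_simplicial (hI : G.IsIntervalGraph) {s : Finset V} (hs : s.Nonempty) :
    ∃ v ∈ s, ∀ a ∈ s, ∀ b ∈ s, G.dist v a = 1 → G.dist v b = 1 → G.dist a b ≤ 1 := by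
  obtain ⟨l, r, hlr, hadj⟩ := hI
  obtain ⟨v, hv, hmin⟩ := s.exists_min_image r hs
  refine ⟨v, hv, fun a ha b hb hva hvb => ?_⟩
  have key : ∀ a ∈ s, G.dist v a = 1 → l a ≤ r v ∧ r v ≤ r a := by
    intro a ha hva
    have h := SimpleGraph.dist_eq_one_iff_adj.1 hva
    obtain ⟨x, ⟨-, h1⟩, h2, -⟩ := (hadj v a h.ne).1 h
    exact ⟨h2.trans h1, hmin a ha⟩
  obtain ⟨a1, a2⟩ := key a ha hva
  obtain ⟨b1, b2⟩ := key b hb hvb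
  exact dist_le_one_of_overlap hlr hadj (a1.trans b2) (b1.trans a2)

end PackingColoring

/-! ### Filling the slots -/

namespace PackingColoring

variable {n : ℕ}

/-- A partial packing coloring with colors between `2` and `d - 1`, where `0` stands for no color,
together with a bound on the colors in use. -/
structure IsPartialPacking (D : Fin n → Fin n → ℕ) (d : ℕ) (p : (Fin n → ℕ) × ℕ) : Prop where
  range : ∀ v, p.1 v = 0 ∨ 2 ≤ p.1 v ∧ p.1 v < d
  le : ∀ v, p.1 v ≤ p.2
  one_le : 1 ≤ p.2
  lt : p.2 < d
  sep : ∀ u v, u ≠ v → p.1 u = p.1 v → p.1 u ≠ 0 → p.1 u < D u v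

theorem IsPartialPacking.fillStep {D : Fin n → Fin n → ℕ} (hD : ∀ u v, D u v = D v u) {d : ℕ}
    {p : (Fin n → ℕ) × ℕ} (hp : IsPartialPacking D d p) {c : ℕ} (hc : 2 ≤ c) (hcd : c < d)
    (g : ℕ) : IsPartialPacking D d (fillStep D c g p) := by
  unfold PackingColoring.fillStep
  split_ifs with hg h
  · obtain ⟨h0, hsep⟩ := h
    refine ⟨fun v => ?_, fun v => ?_, hp.one_le.trans (le_max_left _ _), max_lt hp.lt hcd,
      fun u v huv => ?_⟩
    · simp only [Function.update_apply]
      split_ifs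
      exacts [Or.inr ⟨hc, hcd⟩, hp.range v]
    · simp only [Function.update_apply]
      split_ifs
      exacts [le_max_right _ _, (hp.le v).trans (le_max_left _ _)]
    · simp only [Function.update_apply]
      split_ifs with h1 h2 h2
      · exact absurd (h1.trans h2.symm) huv
      · intro h _
        rw [h1, hD]
        exact hsep v h.symm
      · intro h _
        rw [h, h2]
        exact hsep u h
      · exact hp.sep u v huv
  all_goals exact hp

theorem isPartialPacking_fill {D : Fin n → Fin n → ℕ} (hD : ∀ u v, D u v = D v u) {d E : ℕ}
    (hd : 2 ≤ d) {S : ℕ → ℕ} (hS : ∀ j < E, 2 ≤ S j ∧ S j < d) (N : ℕ) {j : ℕ} (hj : j ≤ E) :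
    IsPartialPacking D d (fill D S N j) := by
  induction j with
  | zero => exact ⟨by simp [fill], by simp [fill], le_rfl, hd, by simp [fill]⟩
  | succ j ih => exact (ih (by omega)).fillStep hD (hS j (by omega)).1 (hS j (by omega)).2 _

theorem slotColors_mem {d q c : ℕ} (hq : q ≤ d * d) (hc : c ∈ slotColors d q) :
    2 ≤ c ∧ c < d := by
  obtain ⟨a, ha, rfl⟩ := List.mem_map.1 hc
  rw [List.mem_filter, List.mem_range, decide_eq_true_iff] at ha
  exact ⟨ha.2.1, Nat.div_lt_of_lt_mul (by omega)⟩

/-- Processing slots the digits of which name vertices with the right colors in `φ` gives a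
restriction of `φ`. -/
theorem fill_eq {D : Fin n → Fin n → ℕ} {φ : Fin n → ℕ} {k E N : ℕ} {S : ℕ → ℕ} (hk : 1 ≤ k)
    (hle : ∀ v, φ v ≤ k) (hsep : ∀ u v, u ≠ v → φ u = φ v → φ u ≠ 0 → φ u < D u v)
    (hS : ∀ j < E, ∀ v : Fin n, N / (n + 1) ^ j % (n + 1) = v → φ v = S j ∧ S j ≠ 0) {j : ℕ}
    (hj : j ≤ E) :
    (fill D S N j).2 ≤ k ∧ (∀ v, (fill D S N j).1 v = 0 ∨ (fill D S N j).1 v = φ v) ∧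
      ∀ i < j, ∀ v : Fin n, N / (n + 1) ^ i % (n + 1) = v → (fill D S N j).1 v = φ v := by
  induction j with
  | zero => exact ⟨hk, fun v => Or.inl rfl, by simp⟩
  | succ j ih =>
    obtain ⟨h1, h2, h3⟩ := ih (by omega)
    simp only [fill, fillStep]
    set p := fill D S N j
    set g := N / (n + 1) ^ j % (n + 1) with hg
    by_cases hgn : g < n
    · have hv := hS j (by omega) ⟨g, hgn⟩ rfl
      simp only [dif_pos hgn]
      by_cases h0 : p.1 ⟨g, hgn⟩ = 0
      · rw [if_pos]
        · refine ⟨max_le h1 (by rw [← hv.1]; exact hle _), fun v => ?_, fun i hi v hiv => ?_⟩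
          · simp only [Function.update_apply]
            split_ifs with h
            · right
              rw [h, hv.1]
            · exact h2 v
          · simp only [Function.update_apply]
            split_ifs with h
            · rw [h, hv.1]
            · rcases Nat.lt_succ_iff_lt_or_eq.1 hi with hi | rfl
              · exact h3 i hi v hiv
              · exact absurd (Fin.ext hiv.symm) h
        · refine ⟨h0, fun u hu => ?_⟩
          have hφ : φ u = S j := by
            rcases h2 u with h | h
            · exact absurd (hu.symm.trans h) hv.2
            · rw [← h, hu]
          rw [← hφ]
          refine hsep u _ ?_ (hφ.trans hv.1.symm) (by rw [hφ]; exact hv.2)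
          rintro rfl
          exact hv.2 (hu.symm.trans h0)
      · rw [if_neg (fun h => h0 h.1)]
        refine ⟨h1, h2, fun i hi v hiv => ?_⟩
        rcases Nat.lt_succ_iff_lt_or_eq.1 hi with hi | rfl
        · exact h3 i hi v hiv
        · have : v = ⟨g, hgn⟩ := Fin.ext hiv.symm
          rw [this]
          exact (h2 _).resolve_left h0
    · simp only [dif_neg hgn]
      refine ⟨h1, h2, fun i hi v hiv => ?_⟩
      rcases Nat.lt_succ_iff_lt_or_eq.1 hi with hi | rfl
      · exact h3 i hi v hiv
      · exact absurd (by have := v.2; omega) hgn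

/-- The position of `v` in its color class. -/
def rank (φ : Fin n → ℕ) (v : Fin n) : ℕ := (Finset.univ.filter fun u => φ u = φ v ∧ u < v).card

theorem rank_injective {φ : Fin n → ℕ} {u v : Fin n} (hφ : φ u = φ v)
    (h : rank φ u = rank φ v) : u = v := by
  have key : ∀ {u v : Fin n}, φ u = φ v → u < v → rank φ u < rank φ v := by
    intro u v hφ huv
    refine Finset.card_lt_card ⟨fun w hw => ?_, fun hsub => ?_⟩
    · simp only [Finset.mem_filter, Finset.mem_univ, true_and] at hw ⊢
      exact ⟨hw.1.trans hφ, hw.2.trans huv⟩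
    · have := hsub (Finset.mem_filter.2 ⟨Finset.mem_univ u, hφ, huv⟩)
      simp at this
  rcases lt_trichotomy u v with huv | huv | huv
  · exact absurd h (key hφ huv).ne
  · exact huv
  · exact absurd h.symm (key hφ.symm huv).ne

theorem rank_lt (φ : Fin n → ℕ) (v : Fin n) :
    rank φ v < (Finset.univ.filter fun u => φ u = φ v).card := by
  refine Finset.card_lt_card ⟨fun w hw => ?_, fun hsub => ?_⟩
  · simp only [Finset.mem_filter, Finset.mem_univ, true_and] at hw ⊢
    exact hw.1
  · have := hsub (Finset.mem_filter.2 ⟨Finset.mem_univ v, rfl⟩)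
    simp at this

/-- There is a number with prescribed digits to the base `b`. -/
theorem exists_digits (b E : ℕ) (g : ℕ → ℕ) (hg : ∀ j, g j < b) :
    ∃ N < b ^ E, ∀ j < E, N / b ^ j % b = g j := by
  refine ⟨finFunctionFinEquiv fun j : Fin E => (⟨g j, hg j⟩ : Fin b), Fin.isLt _, fun j hj => ?_⟩
  have := congrFun (finFunctionFinEquiv.symm_apply_apply
    fun j : Fin E => (⟨g j, hg j⟩ : Fin b)) ⟨j, hj⟩
  exact congrArg Fin.val this

/-- Every partial packing coloring with small color classes arises from some number. -/
theorem exists_fill_eq {D : Fin n → Fin n → ℕ} {φ : Fin n → ℕ} {k d : ℕ} (hd : 2 ≤ d) (hk : 1 ≤ k)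
    (hle : ∀ v, φ v ≤ k) (hrange : ∀ v, φ v = 0 ∨ 2 ≤ φ v ∧ φ v < d)
    (hsep : ∀ u v, u ≠ v → φ u = φ v → φ u ≠ 0 → φ u < D u v)
    (hcard : ∀ v, φ v ≠ 0 →
      (φ v - 1) * ((Finset.univ.filter fun u => φ u = φ v).card - 1) ≤ d - 2) :
    ∃ N < (n + 1) ^ (slotColors d (d * d)).length,
      (fill D ((slotColors d (d * d)).getD · 0) N (slotColors d (d * d)).length).1 = φ ∧
      (fill D ((slotColors d (d * d)).getD · 0) N (slotColors d (d * d)).length).2 ≤ k := by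
  classical
  set L := (List.range (d * d)).filter (IsSlot d ·) with hL
  have hLS : slotColors d (d * d) = L.map (· / d) := rfl
  have hlen : (slotColors d (d * d)).length = L.length := by rw [hLS, List.length_map]
  let g : ℕ → ℕ := fun j =>
    if h : ∃ v, φ v ≠ 0 ∧ φ v = L.getD j 0 / d ∧ rank φ v = L.getD j 0 % d then
      (h.choose : ℕ) else n
  have hg : ∀ j, g j < n + 1 := by
    intro j
    simp only [g]
    split_ifs
    · exact Nat.lt_succ_of_lt (Fin.is_lt _)
    · exact Nat.lt_succ_self n
  obtain ⟨N, hN, hdig⟩ := exists_digits (n + 1) L.length g hg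
  have hget : ∀ j < L.length, (L.map (· / d)).getD j 0 = L.getD j 0 / d := by
    intro j hj
    rw [List.getD_eq_getElem _ _ (by simpa using hj), List.getD_eq_getElem _ _ hj,
      List.getElem_map]
  have hS : ∀ j < L.length, ∀ v : Fin n, N / (n + 1) ^ j % (n + 1) = v →
      φ v = (L.map (· / d)).getD j 0 ∧ (L.map (· / d)).getD j 0 ≠ 0 := by
    intro j hj v hv
    rw [hdig j hj] at hv
    by_cases h : ∃ v, φ v ≠ 0 ∧ φ v = L.getD j 0 / d ∧ rank φ v = L.getD j 0 % d
    · have hgj : g j = h.choose := dif_pos h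
      have hvc : v = h.choose := Fin.ext (hv.symm.trans hgj)
      have hspec := h.choose_spec
      rw [← hvc] at hspec
      rw [hget j hj, ← hspec.2.1]
      exact ⟨rfl, hspec.1⟩
    · have hgj : g j = n := dif_neg h
      have := v.2
      omega
  obtain ⟨h1, h2, h3⟩ := fill_eq (D := D) hk hle hsep hS le_rfl
  rw [hlen, hLS]
  refine ⟨N, hN, funext fun v => ?_, h1⟩
  rcases eq_or_ne (φ v) 0 with h0 | h0
  · rcases h2 v with h | h
    · rw [h, h0]
    · exact h
  · -- the slot number `rank φ v` of the color `φ v` is reserved for `v`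
    have hr := (hrange v).resolve_left h0
    have hrank : (φ v - 1) * rank φ v ≤ d - 2 :=
      (Nat.mul_le_mul_left _ (Nat.le_sub_one_of_lt (rank_lt φ v))).trans (hcard v h0)
    have hrd : rank φ v < d := by
      have : rank φ v ≤ (φ v - 1) * rank φ v := Nat.le_mul_of_pos_left _ (by omega)
      omega
    set q := φ v * d + rank φ v with hq
    have hqd : q / d = φ v := by
      rw [hq, mul_comm, Nat.mul_add_div (by omega), Nat.div_eq_of_lt hrd, add_zero]
    have hqm : q % d = rank φ v := by
      rw [hq, mul_comm, Nat.mul_add_mod, Nat.mod_eq_of_lt hrd]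
    have hqL : q ∈ L := by
      rw [hL, List.mem_filter, List.mem_range, decide_eq_true_iff, IsSlot, hqd, hqm]
      exact ⟨RAM.index_lt hr.2 hrd, by omega, by omega⟩
    obtain ⟨j, hj, hjq⟩ := List.getElem_of_mem hqL
    have hjq' : L.getD j 0 = q := by rw [List.getD_eq_getElem _ _ hj, hjq]
    refine h3 j hj v ?_
    rw [hdig j hj]
    have h : ∃ v, φ v ≠ 0 ∧ φ v = L.getD j 0 / d ∧ rank φ v = L.getD j 0 % d :=
      ⟨v, h0, by rw [hjq', hqd], by rw [hjq', hqm]⟩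
    have hspec := h.choose_spec
    have hgj : g j = h.choose := dif_pos h
    rw [hgj, rank_injective (hspec.2.1.trans (by rw [hjq', hqd]))
      (hspec.2.2.trans (by rw [hjq', hqm]))]

end PackingColoring

/-! ### Maximum independent sets by simplicial elimination -/

namespace PackingColoring

variable {n : ℕ} {D : Fin n → Fin n → ℕ} {d : ℕ}

/-- The situation after some steps of the elimination that started from the coloring `col₀`. -/
structure MisInv (D : Fin n → Fin n → ℕ) (d : ℕ) (col₀ col : Fin n → ℕ) : Prop where
  old : ∀ v, col₀ v ≠ 0 → col v = col₀ v
  new : ∀ v, col₀ v = 0 → col v = 0 ∨ col v = 1 ∨ col v = d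
  indep : ∀ u v, u ≠ v → col u = 1 → col v = 1 → 1 < D u v
  far : ∀ u v, col u = 0 → col v = 1 → 1 < D u v
  /-- The vertices colored with `1` extend to a maximum independent set. -/
  exchange : ∀ T : Finset (Fin n), (∀ v ∈ T, col₀ v = 0) →
    (∀ u ∈ T, ∀ v ∈ T, u ≠ v → 1 < D u v) →
    ∃ T' : Finset (Fin n), (∀ u ∈ T', ∀ v ∈ T', u ≠ v → 1 < D u v) ∧
      (∀ v, col v = 1 → v ∈ T') ∧ (∀ v ∈ T', col v = 0 ∨ col v = 1) ∧ T.card ≤ T'.card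

theorem MisInv.step (hsymm : ∀ u v, D u v = D v u) (hpos : ∀ u v, u ≠ v → D u v ≠ 0)
    (hd : 2 ≤ d) {col₀ col : Fin n → ℕ} (h : MisInv D d col₀ col) (v : Fin n) :
    MisInv D d col₀ (misStep D d col v) := by
  unfold misStep
  split_ifs with hv
  · obtain ⟨hv0, hsim⟩ := hv
    have hnew : ∀ a, (if a = v then 1 else if col a = 0 ∧ D v a = 1 then d else col a) = 1 ↔
        a = v ∨ col a = 1 := by
      intro a
      split_ifs with h1 h2
      · simp [h1]
      · have : col a ≠ 1 := by omega
        simp only [h1, this, or_self, iff_false]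
        omega
      · simp [h1]
    have hzero : ∀ a, (if a = v then 1 else if col a = 0 ∧ D v a = 1 then d else col a) = 0 ↔
        a ≠ v ∧ col a = 0 ∧ D v a ≠ 1 := by
      intro a
      split_ifs with h1 h2
      · simp [h1]
      · simp only [h2, ne_eq, not_true_eq_false, and_false, iff_false]
        omega
      · constructor
        · exact fun h => ⟨h1, h, fun h' => h2 ⟨h, h'⟩⟩
        · exact fun h => h.2.1
    refine ⟨fun a ha => ?_, fun a ha => ?_, fun a b hab => ?_, fun a b => ?_,
      fun T hT hTi => ?_⟩
    · have hca := h.old a ha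
      rw [if_neg, if_neg, hca]
      · exact fun h => ha (hca.symm.trans h.1)
      · rintro rfl
        exact ha (hca.symm.trans hv0)
    · split_ifs
      exacts [Or.inr (Or.inl rfl), Or.inr (Or.inr rfl), h.new a ha]
    · rw [hnew, hnew]
      rintro (rfl | ha) (rfl | hb)
      · exact absurd rfl hab
      · exact h.far _ _ hv0 hb
      · rw [hsymm]
        exact h.far _ _ hv0 ha
      · exact h.indep a b hab ha hb
    · rw [hnew, hzero]
      rintro ⟨hav, ha, hD⟩ (rfl | hb)
      · have := hpos b a (Ne.symm hav)
        rw [hsymm]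
        omega
      · exact h.far a b ha hb
    · obtain ⟨T', hi, h1, h01, hcard⟩ := h.exchange T hT hTi
      have hfar : ∀ a, col a = 1 → D v a ≠ 1 := fun a ha => (h.far v a hv0 ha).ne'
      refine ⟨insert v (T'.filter fun a => D v a ≠ 1), ?_, ?_, ?_, ?_⟩
      · have hva : ∀ a ∈ T'.filter fun a => D v a ≠ 1, a ≠ v → 1 < D v a := by
          intro a ha hav
          have h2 := (Finset.mem_filter.1 ha).2
          have h3 := hpos v a (Ne.symm hav)
          omega
        intro a ha b hb hab
        rcases Finset.mem_insert.1 ha with rfl | ha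
        · rcases Finset.mem_insert.1 hb with rfl | hb
          · exact absurd rfl hab
          · exact hva b hb (Ne.symm hab)
        · rcases Finset.mem_insert.1 hb with rfl | hb
          · rw [hsymm]
            exact hva a ha hab
          · exact hi a (Finset.mem_filter.1 ha).1 b (Finset.mem_filter.1 hb).1 hab
      · intro a ha
        rcases (hnew a).1 ha with rfl | ha
        · exact Finset.mem_insert_self _ _
        · exact Finset.mem_insert_of_mem (Finset.mem_filter.2 ⟨h1 a ha, hfar a ha⟩)
      · intro a ha
        rw [hnew, hzero]
        by_cases hav : a = v
        · exact Or.inr (Or.inl hav)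
        · obtain ⟨ha, hD⟩ := Finset.mem_filter.1 ((Finset.mem_insert.1 ha).resolve_left hav)
          rcases h01 a ha with h0 | h0
          · exact Or.inl ⟨hav, h0, hD⟩
          · exact Or.inr (Or.inr h0)
      · refine hcard.trans ?_
        have hsplit := Finset.card_filter_add_card_filter_not (s := T') (fun a => D v a ≠ 1)
        rcases (T'.filter fun a => ¬ D v a ≠ 1).eq_empty_or_nonempty with he | ⟨a, ha⟩
        · rw [he, Finset.card_empty] at hsplit
          have := Finset.card_le_card (Finset.subset_insert v (T'.filter fun a => D v a ≠ 1))
          omega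
        · -- at most one neighbor of `v` is lost, because these neighbors form a clique
          have hone : (T'.filter fun a => ¬ D v a ≠ 1).card ≤ 1 := by
            refine Finset.card_le_one.2 fun a ha b hb => ?_
            rw [Finset.mem_filter, not_not] at ha hb
            by_contra hab
            refine absurd (hi a ha.1 b hb.1 hab) (not_lt.2 (hsim a b ?_ ?_ ha.2 hb.2))
            · exact (h01 a ha.1).resolve_right fun h => hfar a h ha.2
            · exact (h01 b hb.1).resolve_right fun h => hfar b h hb.2
          rw [Finset.mem_filter, not_not] at ha
          have hvT : v ∉ T'.filter fun a => D v a ≠ 1 := by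
            intro hvT
            have hva : v ≠ a := by
              rintro rfl
              exact (Finset.mem_filter.1 hvT).2 ha.2
            have := hi v (Finset.mem_filter.1 hvT).1 a ha.1 hva
            omega
          rw [Finset.card_insert_of_notMem hvT]
          omega
  · exact h

theorem misInv_mis [NeZero n] (hsymm : ∀ u v, D u v = D v u) (hpos : ∀ u v, u ≠ v → D u v ≠ 0)
    (hd : 2 ≤ d) {col₀ : Fin n → ℕ} (h : ∀ v, col₀ v ≠ 1) (q : ℕ) :
    MisInv D d col₀ (mis D d col₀ q) := by
  induction q with
  | zero =>
    exact ⟨fun _ _ => rfl, fun v hv => Or.inl hv, fun u _ _ hu => absurd hu (h u),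
      fun _ v _ hv => absurd hv (h v), fun T hT hTi =>
        ⟨T, hTi, fun v hv => absurd hv (h v), fun v hv => Or.inl (hT v hv), le_rfl⟩⟩
  | succ q ih => exact ih.step hsymm hpos hd _

theorem misStep_zero {col : Fin n → ℕ} {v a : Fin n} (h : misStep D d col v a = 0) :
    col a = 0 := by
  unfold misStep at h
  split_ifs at h with h1
  · dsimp only at h
    split_ifs at h with h2 h3
    · exact h3.1
    · exact h
  · exact h

theorem mis_zero [NeZero n] {col : Fin n → ℕ} {q r : ℕ} (hqr : q ≤ r) {a : Fin n}
    (h : mis D d col r a = 0) : mis D d col q a = 0 := by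
  induction r, hqr using Nat.le_induction with
  | base => exact h
  | succ r _ ih => exact ih (misStep_zero h)

/-- Each pass through all vertices decides about at least one of them. -/
theorem card_undecided_le [NeZero n] {col : Fin n → ℕ}
    (hsim : ∀ c : Fin n → ℕ, (∃ v, c v = 0) → ∃ v, c v = 0 ∧ IsSimplicial D c v) (r : ℕ) :
    (Finset.univ.filter fun a => mis D d col (r * n) a = 0).card ≤ n - r := by
  induction r with
  | zero => exact (Finset.card_le_univ _).trans_eq (Fintype.card_fin n)
  | succ r ih =>
    rw [Nat.succ_mul]
    by_cases hex : ∃ v, mis D d col (r * n) v = 0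
    · obtain ⟨v, hv, hs⟩ := hsim _ hex
      have hlt : (Finset.univ.filter fun a => mis D d col (r * n + n) a = 0).card <
          (Finset.univ.filter fun a => mis D d col (r * n) a = 0).card := by
        refine Finset.card_lt_card (Finset.ssubset_iff_subset_ne.2 ⟨fun a ha => ?_, fun heq => ?_⟩)
        · rw [Finset.mem_filter] at ha ⊢
          exact ⟨ha.1, mis_zero (Nat.le_add_right _ _) ha.2⟩
        · have hiff : ∀ a, mis D d col (r * n + v) a = 0 ↔ mis D d col (r * n) a = 0 := by
            intro a
            refine ⟨mis_zero (Nat.le_add_right _ _), fun h => ?_⟩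
            have : a ∈ Finset.univ.filter fun a => mis D d col (r * n + n) a = 0 := by
              rw [heq]
              exact Finset.mem_filter.2 ⟨Finset.mem_univ a, h⟩
            exact mis_zero (by have := v.2; omega) (Finset.mem_filter.1 this).2
          have hvn : v ∈ Finset.univ.filter fun a => mis D d col (r * n + n) a = 0 := by
            rw [heq]
            exact Finset.mem_filter.2 ⟨Finset.mem_univ v, hv⟩
          have hlast := mis_zero (q := r * n + v + 1) (by have := v.2; omega)
            (Finset.mem_filter.1 hvn).2
          have hofNat : Fin.ofNat n (r * n + v) = v := by
            apply Fin.ext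
            change (r * n + v) % n = v
            rw [mul_comm, Nat.mul_add_mod, Nat.mod_eq_of_lt v.2]
          rw [mis, hofNat, misStep, if_pos] at hlast
          · simp at hlast
          · refine ⟨(hiff v).2 hv, fun a b ha hb => hs a b ((hiff a).1 ha) ((hiff b).1 hb)⟩
      omega
    · have : (Finset.univ.filter fun a => mis D d col (r * n + n) a = 0) = ∅ := by
        refine Finset.filter_eq_empty_iff.2 fun a _ ha => hex ⟨a, ?_⟩
        exact mis_zero (Nat.le_add_right _ _) ha
      rw [this, Finset.card_empty]
      exact Nat.zero_le _

theorem mis_ne_zero [NeZero n] {col : Fin n → ℕ}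
    (hsim : ∀ c : Fin n → ℕ, (∃ v, c v = 0) → ∃ v, c v = 0 ∧ IsSimplicial D c v) (v : Fin n) :
    mis D d col (n * n) v ≠ 0 := by
  have h := card_undecided_le (D := D) (d := d) (col := col) hsim n
  rw [Nat.sub_self, Nat.le_zero, Finset.card_eq_zero, Finset.filter_eq_empty_iff] at h
  exact h (Finset.mem_univ v)

end PackingColoring

/-! ### The algorithm computes the packing chromatic number -/

namespace PackingColoring

variable {n d : ℕ}

theorem isPackingColoring_iff {V : Type*} {G : SimpleGraph V} (hG : G.Connected) {k : ℕ}
    {φ : V → ℕ} : G.IsPackingColoring k φ ↔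
      (∀ v, 1 ≤ φ v ∧ φ v ≤ k) ∧ ∀ u v, u ≠ v → φ u = φ v → φ u < G.dist u v := by
  have h : ∀ (c : ℕ) (u v : V), ((c + 1 : ℕ) : ℕ∞) ≤ G.edist u v ↔ c < G.dist u v := by
    intro c u v
    rw [← (hG.preconnected u v).coe_dist_eq_edist, Nat.cast_le, Nat.succ_le_iff]
  simp only [SimpleGraph.IsPackingColoring, h]

theorem exists_simplicial_undecided {G : SimpleGraph (Fin n)} (hI : G.IsIntervalGraph)
    (c : Fin n → ℕ) (hc : ∃ v, c v = 0) : ∃ v, c v = 0 ∧ IsSimplicial G.dist c v := by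
  obtain ⟨v, hv⟩ := hc
  obtain ⟨w, hw, h⟩ := exists_simplicial hI (s := Finset.univ.filter fun v => c v = 0)
    ⟨v, Finset.mem_filter.2 ⟨Finset.mem_univ v, hv⟩⟩
  exact ⟨w, (Finset.mem_filter.1 hw).2, fun a b ha hb =>
    h a (Finset.mem_filter.2 ⟨Finset.mem_univ a, ha⟩) b (Finset.mem_filter.2 ⟨Finset.mem_univ b, hb⟩)⟩

theorem exists_coloring_result [NeZero n] {G : SimpleGraph (Fin n)} (hG : G.Connected)
    (hI : G.IsIntervalGraph) {E : ℕ} {S : ℕ → ℕ} (hd : 2 ≤ d)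
    (hS : ∀ j < E, 2 ≤ S j ∧ S j < d) (N : ℕ) :
    ∃ φ, G.IsPackingColoring (result G.dist d E S N) φ := by
  have hsymm : ∀ u v, G.dist u v = G.dist v u := fun u v => SimpleGraph.dist_comm
  have hp := isPartialPacking_fill hsymm hd hS N (le_refl E)
  simp only [isPackingColoring_iff hG, result]
  set p := fill G.dist S N E
  have hp1 : ∀ v, p.1 v ≠ 1 := fun v => by
    have := hp.range v
    omega
  have hinv := misInv_mis hsymm (fun u v huv => (hG.pos_dist_of_ne huv).ne') hd hp1 (n * n)
  have hne := mis_ne_zero (D := G.dist) (d := d) (col := p.1) (exists_simplicial_undecided hI)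
  set col := mis G.dist d p.1 (n * n)
  have hcol : ∀ v, col v = d ∨ col v = 1 ∧ p.1 v = 0 ∨ 2 ≤ p.1 v ∧ col v = p.1 v := by
    intro v
    rcases hp.range v with h | h
    · rcases hinv.new v h with h' | h' | h'
      · exact absurd h' (hne v)
      · exact Or.inr (Or.inl ⟨h', h⟩)
      · exact Or.inl h'
    · exact Or.inr (Or.inr ⟨h.1, hinv.old v (by omega)⟩)
  have hlt : p.2 < d := hp.lt
  have h12 : 1 ≤ p.2 := hp.one_le
  have hle : ∀ v, p.1 v ≤ p.2 := hp.le
  refine ⟨fun v => if col v = d then d + rank col v else col v, fun v => ?_,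
    fun u v huv => ?_⟩
  · have hc := hcol v
    have hl := hle v
    dsimp only
    by_cases h1 : col v = d
    · have hr := rank_lt col v
      rw [h1] at hr
      rw [if_pos h1, if_neg (by omega)]
      omega
    · rw [if_neg h1]
      split_ifs <;> omega
  · have hu := hcol u
    have hv := hcol v
    have := hle u
    have := hle v
    dsimp only
    split_ifs with h1 h2 h2
    · intro h
      exact absurd (rank_injective (h1.trans h2.symm) (by omega)) huv
    · omega
    · omega
    · intro h
      rcases hu with hu | ⟨hu, -⟩ | ⟨hu, hu'⟩
      · exact absurd hu h1
      · rw [hu]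
        exact hinv.indep u v huv hu (h ▸ hu)
      · rw [hu']
        exact hp.sep u v huv (by omega) (by omega)

theorem exists_result_le [NeZero n] {G : SimpleGraph (Fin n)} (hG : G.Connected)
    (hI : G.IsIntervalGraph) (hdiam : ∀ u v, G.dist u v ≤ d) (hd : 2 ≤ d) {k : ℕ} {φ : Fin n → ℕ}
    (hφ : G.IsPackingColoring k φ) :
    ∃ N < (n + 1) ^ (slotColors d (d * d)).length,
      result G.dist d (slotColors d (d * d)).length ((slotColors d (d * d)).getD · 0) N ≤ k := by
  classical
  have hsymm : ∀ u v, G.dist u v = G.dist v u := fun u v => SimpleGraph.dist_comm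
  obtain ⟨hr, hs⟩ := (isPackingColoring_iff hG).1 hφ
  set ψ : Fin n → ℕ := fun v => if 2 ≤ φ v ∧ φ v < d then φ v else 0 with hψ
  have hψφ : ∀ v, ψ v ≠ 0 → ψ v = φ v ∧ 2 ≤ φ v ∧ φ v < d := by
    intro v
    simp only [hψ]
    split_ifs with h
    · exact fun _ => ⟨rfl, h⟩
    · exact fun h => absurd rfl h
  have hsep : ∀ u v, u ≠ v → ψ u = ψ v → ψ u ≠ 0 → ψ u < G.dist u v := by
    intro u v huv h h0
    have h1 := hψφ u h0
    have h2 := hψφ v (h ▸ h0)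
    rw [h1.1]
    exact hs u v huv (by omega)
  obtain ⟨N, hN, hfill, hmax⟩ := exists_fill_eq (D := G.dist) (φ := ψ) (k := k) hd
    ((hr 0).1.trans (hr 0).2)
    (fun v => by
      by_cases h : ψ v = 0
      · omega
      · rw [(hψφ v h).1]
        exact (hr v).2)
    (fun v => by
      by_cases h : ψ v = 0
      · exact Or.inl h
      · have := hψφ v h
        omega)
    hsep
    (fun v hv => card_packing_le hG hI hdiam (by omega) fun a ha b hb hab => by
      rw [Finset.mem_filter] at ha hb
      rw [← ha.2]
      exact hsep a b hab (ha.2.trans hb.2.symm) (by rw [ha.2]; exact hv))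
  refine ⟨N, hN, ?_⟩
  simp only [result]
  rw [hfill]
  have hψ1 : ∀ v, ψ v ≠ 1 := fun v h => by
    have := hψφ v (by omega)
    omega
  have hinv := misInv_mis hsymm (fun u v huv => (hG.pos_dist_of_ne huv).ne') hd hψ1 (n * n)
  have hne := mis_ne_zero (D := G.dist) (d := d) (col := ψ) (exists_simplicial_undecided hI)
  set col := mis G.dist d ψ (n * n)
  split_ifs with hU
  · exact hmax
  · have hmem : ∀ {p : Fin n → Prop} [DecidablePred p] {v},
        v ∈ Finset.univ.filter p ↔ p v := by simp
    -- the vertices of color `1` in `φ` are at most as many as those chosen greedily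
    obtain ⟨T', -, -, h01, hcard⟩ := hinv.exchange (Finset.univ.filter fun v => φ v = 1)
      (fun v hv => by
        rw [hmem] at hv
        by_contra h
        have := hψφ v h
        omega)
      (fun u hu v hv huv => by
        rw [hmem] at hu hv
        have := hs u v huv (by omega)
        omega)
    have hT' : T'.card ≤ (Finset.univ.filter fun v => col v = 1).card :=
      Finset.card_le_card fun v hv => hmem.2 ((h01 v hv).resolve_left (hne v))
    have hdisj : Disjoint (Finset.univ.filter fun v => col v = d)
        (Finset.univ.filter fun v => col v = 1) :=
      Finset.disjoint_left.2 fun v hv hv' => by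
        rw [hmem] at hv hv'
        omega
    have hsub : (Finset.univ.filter fun v => col v = d) ∪ (Finset.univ.filter fun v => col v = 1) ⊆
        (Finset.univ.filter fun v => φ v = 1) ∪ (Finset.univ.filter fun v => d ≤ φ v) := by
      intro v hv
      rw [Finset.mem_union, hmem, hmem] at hv ⊢
      by_contra hcon
      have h1 := (hr v).1
      have hv' : ψ v = φ v := by
        simp only [hψ]
        rw [if_pos]
        omega
      have := hinv.old v (by omega)
      omega
    have h1 := Finset.card_le_card hsub
    rw [Finset.card_union_of_disjoint hdisj] at h1
    have h2 := Finset.card_union_le (Finset.univ.filter fun v => φ v = 1)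
      (Finset.univ.filter fun v => d ≤ φ v)
    -- colors from `d` on are used only once
    have h3 : (Finset.univ.filter fun v => d ≤ φ v).card ≤ (Finset.Icc d k).card := by
      refine Finset.card_le_card_of_injOn φ (fun v hv => ?_) fun u hu v hv huv => ?_
      · rw [Finset.mem_coe, hmem] at hv
        rw [Finset.mem_coe, Finset.mem_Icc]
        exact ⟨hv, (hr v).2⟩
      · rw [Finset.mem_coe, hmem] at hu hv
        by_contra hne
        have := hs u v hne huv
        have := hdiam u v
        omega
    rw [Nat.card_Icc] at h3
    omega

theorem best_le [NeZero n] (D : Fin n → Fin n → ℕ) (E : ℕ) (S : ℕ → ℕ) {i N : ℕ} (hi : i < N) :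
    best D d E S N ≤ result D d E S i := by
  induction N with
  | zero => omega
  | succ N ih =>
    rcases Nat.lt_succ_iff_lt_or_eq.1 hi with h | rfl
    · exact (min_le_left _ _).trans (ih h)
    · exact min_le_right _ _

theorem best_eq [NeZero n] (D : Fin n → Fin n → ℕ) (E : ℕ) (S : ℕ → ℕ) (N : ℕ) :
    best D d E S N = n ∨ ∃ i, best D d E S N = result D d E S i := by
  induction N with
  | zero => exact Or.inl rfl
  | succ N ih =>
    rcases min_choice (best D d E S N) (result D d E S N) with h | h
    · rcases ih with h' | ⟨i, h'⟩
      · exact Or.inl (h.trans h')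
      · exact Or.inr ⟨i, h.trans h'⟩
    · exact Or.inr ⟨N, h⟩

theorem isPackingColoring_injective (G : SimpleGraph (Fin n)) :
    G.IsPackingColoring n fun v => v + 1 :=
  ⟨fun v => ⟨Nat.succ_pos _, v.2⟩,
    fun u v huv h => absurd (Fin.ext (by simpa using h)) huv⟩

theorem best_eq_packingChromaticNumber [NeZero n] {G : SimpleGraph (Fin n)} (hG : G.Connected)
    (hI : G.IsIntervalGraph) (hdiam : ∀ u v, G.dist u v ≤ d) (hd : 2 ≤ d) :
    (best G.dist d (slotColors d (d * d)).length ((slotColors d (d * d)).getD · 0)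
      ((n + 1) ^ (slotColors d (d * d)).length) : ℕ∞) = G.packingChromaticNumber := by
  refine le_antisymm (le_iInf₂ fun k hk => ?_) (iInf₂_le _ ?_)
  · obtain ⟨φ, hφ⟩ := hk
    obtain ⟨N, hN, hle⟩ := exists_result_le hG hI hdiam hd hφ
    exact_mod_cast (best_le _ _ _ hN).trans hle
  · rcases best_eq (d := d) G.dist (slotColors d (d * d)).length
      ((slotColors d (d * d)).getD · 0) ((n + 1) ^ (slotColors d (d * d)).length) with h | ⟨i, h⟩
    · rw [h]
      exact ⟨_, isPackingColoring_injective G⟩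
    · rw [h]
      refine exists_coloring_result hG hI hd (fun j hj => slotColors_mem le_rfl (q := d * d) ?_) i
      rw [List.getD_eq_getElem _ _ hj]
      exact List.getElem_mem hj

/-- With diameter at most `1`, no two vertices may have the same color. -/
theorem packingChromaticNumber_of_diam_le_one {G : SimpleGraph (Fin n)} (hG : G.Connected)
    (hdiam : ∀ u v, G.dist u v ≤ 1) : G.packingChromaticNumber = n := by
  refine le_antisymm (iInf₂_le _ ⟨_, isPackingColoring_injective G⟩) (le_iInf₂ fun k hk => ?_)
  obtain ⟨φ, hφ⟩ := hk
  obtain ⟨hr, hs⟩ := (isPackingColoring_iff hG).1 hφ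
  have h : (Finset.univ : Finset (Fin n)).card ≤ (Finset.Icc 1 k).card := by
    refine Finset.card_le_card_of_injOn φ (fun v _ => ?_) fun u _ v _ huv => ?_
    · rw [Finset.mem_coe, Finset.mem_Icc]
      exact hr v
    · by_contra hne
      have h1 := hs u v hne huv
      have h2 := hdiam u v
      have h3 := (hr u).1
      omega
  rw [Finset.card_univ, Fintype.card_fin, Nat.card_Icc, Nat.add_sub_cancel] at h
  exact_mod_cast h

end PackingColoring

/-! ### The exponent of the running time -/

namespace PackingColoring

open Real

/-- Color `j + 1` has at most `(d - 2) / j + 1` slots. -/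
theorem slotColors_length_le_sum {d : ℕ} (hd : 0 < d) :
    (slotColors d (d * d)).length ≤ ∑ j ∈ Finset.Icc 1 (d - 2), ((d - 2) / j + 1) := by
  set s := (Finset.range (d * d)).filter (IsSlot d) with hs
  have hcard : (slotColors d (d * d)).length = s.card := by
    rw [slotColors, List.length_map]
    rfl
  have hmem : ∀ {q}, q ∈ s → q < d * d ∧ 1 < q / d ∧ (q / d - 1) * (q % d) < d - 1 := by
    intro q hq
    rw [hs, Finset.mem_filter, Finset.mem_range] at hq
    exact hq
  rw [hcard, Finset.card_eq_sum_card_fiberwise (f := fun q => q / d - 1)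
    (t := Finset.Icc 1 (d - 2))]
  · refine Finset.sum_le_sum fun j hj => ?_
    rw [Finset.mem_Icc] at hj
    rw [← Finset.card_range ((d - 2) / j + 1)]
    refine Finset.card_le_card_of_injOn (· % d) (fun q hq => ?_) fun a ha b hb hab => ?_
    · rw [Finset.mem_coe, Finset.mem_filter] at hq
      obtain ⟨hq, rfl⟩ := hq
      have := hmem hq
      rw [Finset.mem_coe, Finset.mem_range, Nat.lt_succ_iff, Nat.le_div_iff_mul_le (by omega),
        mul_comm]
      dsimp only
      omega
    · rw [Finset.mem_coe, Finset.mem_filter] at ha hb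
      have h1 := hmem ha.1
      have h2 := hmem hb.1
      have h3 : a / d = b / d := by omega
      rw [← Nat.div_add_mod a d, ← Nat.div_add_mod b d, h3]
      exact congrArg _ hab
  · intro q hq
    have h1 := hmem hq
    have h2 : q / d < d := Nat.div_lt_of_lt_mul h1.1
    rw [Finset.mem_coe, Finset.mem_Icc]
    dsimp only
    omega

theorem slotColors_length_le_harmonic {d : ℕ} (hd : 2 ≤ d) :
    ((slotColors d (d * d)).length : ℝ) ≤ ((d - 2 : ℕ) : ℝ) * (harmonic (d - 2) + 1) := by
  have h : ((slotColors d (d * d)).length : ℝ) ≤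
      ((∑ j ∈ Finset.Icc 1 (d - 2), ((d - 2) / j + 1) : ℕ) : ℝ) :=
    Nat.cast_le.2 (slotColors_length_le_sum (by omega))
  refine h.trans ?_
  set m := d - 2
  rw [harmonic_eq_sum_Icc]
  push_cast
  rw [mul_add, Finset.mul_sum, mul_one, Finset.sum_add_distrib, Finset.sum_const, Nat.card_Icc]
  simp only [Nat.add_sub_cancel, nsmul_eq_mul, mul_one]
  gcongr with j hj
  rw [← div_eq_mul_inv]
  exact Nat.cast_div_le

theorem log_five_gt : (1.6 : ℝ) < log 5 := by
  have h : (8 : ℝ) < log (5 ^ 5) := by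
    rw [lt_log_iff_exp_lt (by norm_num)]
    calc exp 8 = exp 1 ^ 8 := by rw [← exp_nat_mul]; norm_num
      _ < 2.7182818286 ^ 8 := pow_lt_pow_left₀ exp_one_lt_d9 (exp_pos _).le (by norm_num)
      _ < 5 ^ 5 := by norm_num
  rw [log_pow] at h
  norm_num at h ⊢
  linarith

/-- `log m + log 5 - 1` is an upper bound for the `m`-th harmonic number from some `m` on, because
the Euler-Mascheroni constant `0.577...` is smaller than `log 5 - 1 = 0.609...`. -/
theorem harmonic_le_log_add {m : ℕ} (hm : 40 ≤ m) : (harmonic m : ℝ) ≤ log m + log 5 - 1 := by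
  have h := strictAnti_eulerMascheroniSeq'.antitone hm
  rw [eulerMascheroniSeq', eulerMascheroniSeq', if_neg (by omega), if_neg (by omega)] at h
  have h40 : ((harmonic 40 : ℚ) : ℝ) ≤ 4.279 := by
    have : harmonic 40 ≤ 4.279 := by norm_num [harmonic, Finset.sum_range_succ]
    calc ((harmonic 40 : ℚ) : ℝ) ≤ ((4.279 : ℚ) : ℝ) := by exact_mod_cast this
      _ = 4.279 := by norm_num
  have hlog : log ((40 : ℕ) : ℝ) = 3 * log 2 + log 5 := by
    rw [show ((40 : ℕ) : ℝ) = 2 ^ 3 * 5 by norm_num, log_mul (by norm_num) (by norm_num), log_pow]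
    norm_num
  have := log_two_gt_d9
  have := log_five_gt
  linarith

theorem slotColors_length_add_four_le {d : ℕ} (hd : 2 ≤ d) :
    ((slotColors d (d * d)).length : ℝ) + 4 ≤ d * log (5 * d) := by
  have hE := slotColors_length_le_harmonic hd
  obtain ⟨m, rfl⟩ : ∃ m, d = m + 2 := ⟨d - 2, by omega⟩
  rw [Nat.add_sub_cancel] at hE
  refine (add_le_add_left hE 4).trans ?_
  have h5 := log_five_gt
  have h2 := log_two_gt_d9
  have hlog : log (5 * ((m + 2 : ℕ) : ℝ)) = log 5 + log (m + 2) := by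
    rw [log_mul (by norm_num) (by positivity)]
    push_cast
    rfl
  rw [hlog]
  push_cast
  rcases Nat.eq_zero_or_pos m with rfl | hm
  · norm_num
    linarith
  have hm1 : (1 : ℝ) ≤ m := by exact_mod_cast hm
  have hmono : log m ≤ log (m + 2) := log_le_log (by linarith) (by linarith)
  -- it remains to compare the harmonic number with the logarithm
  suffices h : (m : ℝ) * (harmonic m - log m + 1) + 4 ≤ (m + 2) * log 5 + 2 * log (m + 2) by
    nlinarith
  rcases le_or_gt 40 m with h40 | h40
  · have h := harmonic_le_log_add h40
    have h8 : log 2 ≤ log ((m : ℝ) + 2) := log_le_log (by norm_num) (by linarith)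
    nlinarith
  · rcases le_or_gt 6 m with h6 | h6
    · have h := (strictAnti_eulerMascheroniSeq'.antitone h6).trans
        eulerMascheroniSeq'_six_lt_two_thirds.le
      rw [eulerMascheroniSeq', if_neg (by omega)] at h
      have hm40 : (m : ℝ) ≤ 40 := by exact_mod_cast h40.le
      have hm6 : (6 : ℝ) ≤ m := by exact_mod_cast h6
      have h8 : 3 * log 2 ≤ log ((m : ℝ) + 2) := by
        rw [← log_rpow (by norm_num)]
        refine log_le_log (by norm_num) ?_
        norm_num
        linarith
      nlinarith
    · have h : (harmonic m : ℝ) ≤ 1 + log m := harmonic_le_one_add_log m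
      have hm5 : (m : ℝ) ≤ 5 := by exact_mod_cast Nat.lt_succ_iff.1 h6
      rcases le_or_gt 3 m with hm3 | hm3
      · have hm3' : (3 : ℝ) ≤ m := by exact_mod_cast hm3
        have h4 : log 5 ≤ log ((m : ℝ) + 2) := log_le_log (by norm_num) (by linarith)
        nlinarith
      · have hm2' : (m : ℝ) ≤ 2 := by exact_mod_cast Nat.lt_succ_iff.1 hm3
        have h3 : 1 < log 3 := (lt_log_iff_exp_lt (by norm_num)).2 exp_one_lt_three
        have h4 : log 3 ≤ log ((m : ℝ) + 2) := log_le_log (by norm_num) (by linarith)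
        nlinarith

end PackingColoring

/-! ### Running time, word size and input -/

namespace PackingColoring

/-- The constant factor in the bounds on the running time and on the word size. -/
def boundConst (d E : ℕ) : ℕ :=
  2 ^ E * (74 + 32 * E) + 39 + 18 * d + 13 * (d * d) + (4 + 3 * d + d * d + E + 2 ^ E)

theorem succ_pow_le {n : ℕ} (hn : 1 ≤ n) (E : ℕ) : (n + 1) ^ E ≤ 2 ^ E * n ^ E := by
  rw [← mul_pow]
  exact Nat.pow_le_pow_left (by omega) E

theorem timeBound_le {n d E : ℕ} (hn : 1 ≤ n) :
    RAM.timeBound n d E ≤ boundConst d E * n ^ (E + 4) := by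
  have h1 : n ≤ n ^ 4 := Nat.le_self_pow (by norm_num) n
  have h0 : 1 ≤ n ^ 4 := Nat.one_le_pow _ _ hn
  have h2 : n * n ≤ n ^ 4 := by
    rw [← sq]
    exact Nat.pow_le_pow_right hn (by norm_num)
  have h3 : n * n * n ≤ n ^ 4 := by
    rw [← sq, ← pow_succ]
    exact Nat.pow_le_pow_right hn (by norm_num)
  have hE : n ^ 4 ≤ n ^ (E + 4) := Nat.pow_le_pow_right hn (by omega)
  have hbody : n * n * (n * n * 21 + n * 11 + 15) + E * (n * 10 + 22) + n * 10 + 17 ≤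
      (74 + 32 * E) * n ^ 4 := by
    have e : n * n * (n * n * 21 + n * 11 + 15) =
        21 * n ^ 4 + 11 * (n * n * n) + 15 * (n * n) := by ring
    have : E * (n * 10 + 22) ≤ E * (32 * n ^ 4) := Nat.mul_le_mul_left _ (by omega)
    rw [e]
    linarith
  have hmain : (n + 1) ^ E *
      (n * n * (n * n * 21 + n * 11 + 15) + E * (n * 10 + 22) + n * 10 + 17) ≤
      2 ^ E * (74 + 32 * E) * n ^ (E + 4) := by
    refine (Nat.mul_le_mul (succ_pow_le hn E) hbody).trans_eq ?_
    ring
  have hd : n * n * n * d ≤ d * n ^ (E + 4) := by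
    rw [mul_comm]
    exact Nat.mul_le_mul_left _ (h3.trans hE)
  have hdd : d * d ≤ d * d * n ^ (E + 4) := Nat.le_mul_of_pos_right _ (by omega)
  have hslack : 0 ≤ (4 + 3 * d + d * d + E + 2 ^ E) * n ^ (E + 4) := Nat.zero_le _
  rw [RAM.timeBound, boundConst]
  linarith

theorem word_bound {n d E : ℕ} (hn : 1 ≤ n) :
    n * n * n * d + n * n + n + d + d + d * d + E + (n + 1) ^ E + 2 <
      boundConst d E * n ^ (E + 4) := by
  have h1 : n ≤ n ^ (E + 4) := Nat.le_self_pow (by omega) n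
  have h0 : 1 ≤ n ^ (E + 4) := Nat.one_le_pow _ _ hn
  have h2 : n * n ≤ n ^ (E + 4) := by
    rw [← sq]
    exact Nat.pow_le_pow_right hn (by omega)
  have h3 : n * n * n * d ≤ d * n ^ (E + 4) := by
    rw [mul_comm, ← sq, ← pow_succ]
    exact Nat.mul_le_mul_left _ (Nat.pow_le_pow_right hn (by omega))
  have h4 : (n + 1) ^ E ≤ 2 ^ E * n ^ (E + 4) :=
    (succ_pow_le hn E).trans (Nat.mul_le_mul_left _ (Nat.pow_le_pow_right hn (by omega)))
  have h5 : d ≤ d * n ^ (E + 4) := Nat.le_mul_of_pos_right _ (by omega)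
  have h6 : d * d ≤ d * d * n ^ (E + 4) := Nat.le_mul_of_pos_right _ (by omega)
  have h7 : E ≤ E * n ^ (E + 4) := Nat.le_mul_of_pos_right _ (by omega)
  have hslack : 0 ≤ (2 ^ E * (74 + 32 * E) + 18 * d + 13 * (d * d)) * n ^ (E + 4) := Nat.zero_le _
  rw [boundConst]
  linarith

theorem input_mem_le {n : ℕ} (d : ℕ) (G : SimpleGraph (Fin n)) (a : ℕ) :
    (RAM.input d G).mem a ≤ 1 := by
  simp only [RAM.input]
  split_ifs <;> omega

theorem input_mem_eq_one_iff {n : ℕ} (d : ℕ) (G : SimpleGraph (Fin n)) (u v : Fin n) :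
    (RAM.input d G).mem (u * n + v) = 1 ↔ G.Adj u v := by
  simp only [RAM.input]
  split_ifs with h
  · obtain ⟨u', v', he, hadj⟩ := h
    obtain ⟨rfl, rfl⟩ := index_inj he
    simp [hadj]
  · simp only [false_iff]
    exact fun hadj => h ⟨u, v, rfl, hadj⟩

end PackingColoring

open PackingColoring

theorem theorem3 :
    ∃ P : RAM.Prog, ∀ d : ℕ, 1 ≤ d → ∃ C k : ℕ,
      ∀ n : ℕ, 1 ≤ n → ∀ G : SimpleGraph (Fin n), G.IsIntervalGraph → G.ediam ≤ (d : ℕ∞) →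
        ∃ (t : ℕ) (s : RAM.State),
          RAM.Exec (C * n ^ k) P (RAM.input d G) t s ∧
          ((s.reg 0 : ℕ) : ℕ∞) = G.packingChromaticNumber ∧
          (t : ℝ) ≤ (C : ℝ) * (n : ℝ) ^ ((d : ℝ) * Real.log (5 * (d : ℝ))) := by
  refine ⟨RAM.packingProg, fun d hd => ?_⟩
  have hexp : 0 ≤ (d : ℝ) * Real.log (5 * (d : ℝ)) := by
    have : (1 : ℝ) ≤ d := by exact_mod_cast hd
    exact mul_nonneg (by linarith) (Real.log_nonneg (by linarith))
  have hdist : ∀ {n : ℕ}, 1 ≤ n → ∀ {G : SimpleGraph (Fin n)}, G.ediam ≤ (d : ℕ∞) →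
      G.Connected ∧ ∀ u v, G.dist u v ≤ d := by
    intro n hn G hG
    have : NeZero n := ⟨by omega⟩
    have hconn : G.Connected :=
      SimpleGraph.connected_of_ediam_ne_top (ne_top_of_le_ne_top (ENat.natCast_ne_top d) hG)
    refine ⟨hconn, fun u v => ?_⟩
    have h := SimpleGraph.edist_le_ediam.trans hG (a := G.edist u v)
    rwa [← (hconn.preconnected u v).coe_dist_eq_edist, Nat.cast_le] at h
  rcases Nat.lt_or_ge d 2 with hd1 | hd2
  · obtain rfl : d = 1 := by omega
    refine ⟨3, 0, fun n hn G _ hG => ?_⟩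
    obtain ⟨hconn, hdiam⟩ := hdist hn hG
    refine ⟨1 + (1 + 1), (RAM.input 1 G).setReg 2 1,
      .seq (.const _ 2 1 (by norm_num)) (.cond_true rfl (.skip _)), ?_, ?_⟩
    · rw [packingChromaticNumber_of_diam_le_one hconn hdiam]
      rfl
    · have := Real.one_le_rpow (by exact_mod_cast hn : (1 : ℝ) ≤ n) hexp
      push_cast at this ⊢
      linarith
  · set E := (slotColors d (d * d)).length with hE
    refine ⟨boundConst d E, E + 4, fun n hn G hI hG => ?_⟩
    have : NeZero n := ⟨by omega⟩
    obtain ⟨hconn, hdiam⟩ := hdist hn hG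
    obtain ⟨t, s, hexec, ht, hs⟩ := RAM.wp_packingProg (s := RAM.input d G) (D := G.dist) hd2 rfl
      rfl (input_mem_le d G)
      (relax_initMatrix hconn hdiam (input_mem_eq_one_iff d G)) hE (word_bound hn)
    refine ⟨t, s, hexec, ?_, ?_⟩
    · rw [hs]
      exact best_eq_packingChromaticNumber hconn hI hdiam hd2
    · have h1 : (t : ℝ) ≤ (boundConst d E : ℝ) * (n : ℝ) ^ ((E + 4 : ℕ) : ℝ) := by
        rw [Real.rpow_natCast]
        exact_mod_cast ht.trans (timeBound_le hn)
      refine h1.trans (mul_le_mul_of_nonneg_left ?_ (Nat.cast_nonneg _))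
      refine Real.rpow_le_rpow_of_exponent_le (by exact_mod_cast hn) ?_
      push_cast
      exact slotColors_length_add_four_le hd2
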